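/- Let $G_\Delta$ be the infinite triangular grid, in which every node has six neighbours. Let $\mathcal P$ be a finite, nonempty set of nodes that is simply connected, i.e. both $\mathcal P$ and its complement induce connected subgraphs of $G_\Delta$; each node of $\mathcal P$ holds one particle, and the other nodes are empty. Each particle labels its six ports by $\mathbb Z/6$ so that ports $i$ and $i+1$ lead to adjacent nodes; the particles need not agree on a direction or on a chirality. The register of a particle $p$ holds a value $\mathrm{link}_p[v]\in\{\mathit{in},\mathit{out}\}$ for each neighbouring node $v$, and $\mathrm{link}_p[v]=\mathit{in}$ if $v$ is empty. A configuration consists of $\mathcal P$ and the contents of all registers. For adjacent particles $p,q$, the edge $pq$ is directed from $p$ to $q$ (outgoing for $p$) if $\mathrm{link}_p[q]=\mathit{out}$ and $\mathrm{link}_q[p]=\mathit{in}$, and it is undirected if $\mathrm{link}_p[q]=\mathrm{link}_q[p]=\mathit{in}$. Consider the following rules at a particle $p$. - R1: every edge between $p$ and another particle is directed one way or the other. - R2: $p$ has at most three outgoing edges. - R3: in the cyclic order of the ports of $p$, the outgoing edges of $p$ are consecutive. - R4: no triangle of particles containing $p$ is a directed cycle. When $p$ executes the algorithm, it reads its own register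 and those of the neighbouring particles and rewrites its own register as follows. First it sets $\mathrm{link}_p[q]=\mathit{in}$ for every $q$ with $\mathrm{link}_p[q]=\mathrm{link}_q[p]=\mathit{out}$. Then, if R1 fails at $p$, it marks all its undirected edges as outgoing. Then, if R2, R3 or R4 fails at $p$, it marks all its outgoing edges as undirected. A particle is activable in a configuration if executing the algorithm changes its register. A successor of a configuration $C$ is obtained when a nonempty set of particles activable in $C$ execute concurrently, each reading the registers as they are in $C$; it is a sequential successor if this set has one element. A (sequential) execution is an infinite sequence $C_0,C_1,\dots$ of configurations such that, for every $i$, either $C_{i+1}$ is a (sequential) successor of $C_i$, or no particle is activable in $C_i$ and $C_{i+1}=C_i$. It is (sequential) Gouda fair if, for every configuration $C$ that appears infinitely often in it, every (sequential) successor of $C$ appears infinitely often in it. Theorem. Let $C_0,C_1,\dots$ be a Gouda fair execution, or a sequential Gouda fair execution, whose initial configuration $C_0$ has a simply connected support and arbitrary register contents. Then there is an $n$ such that in $C_n$ no particle is activable, every particle satisfies R1–R4, and exactly one particle (the leader) is a sink, i.e. has no outgoing edge. -/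

import Mathlib

namespace ParticleSystem

/-- Nodes of the triangular grid, in the coordinates of a basis of two grid vectors at angle 60°. -/
abbrev Node : Type := ℤ × ℤ

/-- The infinite regular triangular grid: every node has six neighbours. -/
def triGrid : SimpleGraph Node where
  Adj u v := v - u ∈ ({(1, 0), (0, 1), (-1, 1), (-1, 0), (0, -1), (1, -1)} : Set Node)
  symm := ⟨by
    rintro ⟨a, b⟩ ⟨c, d⟩ h
    simp only [Prod.mk_sub_mk, Set.mem_insert_iff, Set.mem_singleton_iff, Prod.mk.injEq] at h ⊢
    omega⟩
  loopless := ⟨by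
    rintro ⟨a, b⟩ h
    simp only [Prod.mk_sub_mk, Set.mem_insert_iff, Set.mem_singleton_iff, Prod.mk.injEq] at h
    omega⟩

/-- A finite set of nodes that is (nonempty and) connected and has a connected complement. -/
structure SimplyConnected (P : Finset Node) : Prop where
  connected : (triGrid.induce (P : Set Node)).Connected
  compl_connected : (triGrid.induce ((P : Set Node)ᶜ)).Connected

/-- Each particle numbers its six ports by `0, …, 5` in such a way that ports `i` and `i + 1 mod 6`
lead to neighbouring nodes. The particles need not agree on a direction, nor on a chirality. -/
structure PortLabelling where
  port : (p : Node) → ZMod 6 ≃ triGrid.neighborSet p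
  consecutive : ∀ p i, triGrid.Adj (port p i : Node) (port p (i + 1) : Node)

/-- The two values of a variable `link_p[v]`. -/
inductive Link
  | inn
  | out

/-- A configuration: the support and the registers. The register of the particle `p` consists of
the variables `link p v` for the neighbouring nodes `v`, which are `inn` if `v` is empty.
(For pairs that are not adjacent particles, `link` carries no information and is `inn`.) -/
@[ext]
structure Config where
  support : Finset Node
  link : Node → Node → Link
  mem_of_out : ∀ p v, link p v = Link.out → p ∈ support ∧ v ∈ support ∧ triGrid.Adj p v

namespace Config

/-- The edge `pq` is directed from `p` to `q`: it is outgoing for `p` and incoming for `q`. -/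
def Outgoing (C : Config) (p q : Node) : Prop :=
  C.link p q = Link.out ∧ C.link q p = Link.inn

/-- `pq` is an edge between two particles and it is undirected. -/
def Undirected (C : Config) (p q : Node) : Prop :=
  p ∈ C.support ∧ q ∈ C.support ∧ triGrid.Adj p q ∧ C.link p q = Link.inn ∧ C.link q p = Link.inn

/-- Both endpoints claim the edge `pq` as outgoing. -/
def Conflicting (C : Config) (p q : Node) : Prop :=
  C.link p q = Link.out ∧ C.link q p = Link.out

/-- R1 at `p`: each edge between `p` and another particle is oriented,
and both endpoints agree on the direction. -/
def R1 (C : Config) (p : Node) : Prop :=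
  ∀ q ∈ C.support, triGrid.Adj p q → C.Outgoing p q ∨ C.Outgoing q p

/-- R2 at `p`: at most three outgoing edges. -/
def R2 (C : Config) (p : Node) : Prop :=
  {q | C.Outgoing p q}.ncard ≤ 3

/-- R3 at `p`: in the cyclic order of the ports, the outgoing edges of `p` are consecutive,
that is, they are at the ports `i, i + 1, …, i + k - 1` for some `i` and `k`. -/
def R3 (L : PortLabelling) (C : Config) (p : Node) : Prop :=
  ∃ (i : ZMod 6) (k : ℕ), ∀ j : ZMod 6,
    C.Outgoing p (L.port p j) ↔ ∃ m : ℕ, m < k ∧ j = i + (m : ZMod 6)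

/-- R4 at `p`: no triangle containing `p` is a directed cycle. -/
def R4 (C : Config) (p : Node) : Prop :=
  ∀ q r, ¬ (C.Outgoing p q ∧ C.Outgoing q r ∧ C.Outgoing r p)

/-- Every particle satisfies R1–R4. -/
def Valid (L : PortLabelling) (C : Config) : Prop :=
  ∀ p ∈ C.support, C.R1 p ∧ C.R2 p ∧ C.R3 L p ∧ C.R4 p

/-- A particle without outgoing edges. -/
def IsSink (C : Config) (p : Node) : Prop :=
  p ∈ C.support ∧ ∀ q, ¬ C.Outgoing p q

open Classical in
/-- The particle `p` writes `r` into its register; the links to empty nodes are always `inn`. -/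
noncomputable def write (C : Config) (p : Node) (r : Node → Link) : Config where
  support := C.support
  link u v :=
    if u = p then
      if u ∈ C.support ∧ v ∈ C.support ∧ triGrid.Adj u v then r v else Link.inn
    else C.link u v
  mem_of_out := by
    intro u v h
    split_ifs at h with h₁ h₂
    · exact h₂
    · exact C.mem_of_out u v h

open Classical in
/-- The special case of the encoding: the activated particle `p` gives up the edges which both
endpoints claim as outgoing, by marking them as `inn`. -/
noncomputable def resolve (C : Config) (p : Node) : Config :=
  C.write p fun q => if C.Conflicting p q then Link.inn else C.link p q

open Classical in
/-- First line: if R1 fails at `p`, mark all undirected edges of `p` as outgoing. -/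
noncomputable def line1 (C : Config) (p : Node) : Config :=
  if ¬ C.R1 p then C.write p fun q => if C.Undirected p q then Link.out else C.link p q else C

open Classical in
/-- Second line: if R2, R3 or R4 fails at `p`, mark all outgoing edges of `p` as undirected. -/
noncomputable def line2 (L : PortLabelling) (C : Config) (p : Node) : Config :=
  if ¬ C.R2 p ∨ ¬ C.R3 L p ∨ ¬ C.R4 p then
    C.write p fun q => if C.Outgoing p q then Link.inn else C.link p q
  else C

/-- The result of the execution of the algorithm by `p` alone: always both lines, in this order. -/
noncomputable def exec (L : PortLabelling) (C : Config) (p : Node) : Config :=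
  ((C.resolve p).line1 p).line2 L p

theorem exec_support (L : PortLabelling) (C : Config) (p : Node) :
    (C.exec L p).support = C.support := by
  have h₁ : ∀ D : Config, (D.line1 p).support = D.support := by
    intro D
    unfold line1
    split_ifs <;> rfl
  have h₂ : ∀ D : Config, (D.line2 L p).support = D.support := by
    intro D
    unfold line2
    split_ifs <;> rfl
  unfold exec
  rw [h₂, h₁]
  rfl

/-- `p` is activable: executing the algorithm modifies the register of `p`. -/
def Activable (L : PortLabelling) (C : Config) (p : Node) : Prop :=
  p ∈ C.support ∧ (C.exec L p).link p ≠ C.link p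

open Classical in
/-- All particles of `Q` execute the algorithm concurrently: each of them reads the registers as
they are in `C` and rewrites its own register. -/
noncomputable def fire (L : PortLabelling) (C : Config) (Q : Finset Node) : Config where
  support := C.support
  link u v := if u ∈ Q then (C.exec L u).link u v else C.link u v
  mem_of_out := by
    intro u v h
    split_ifs at h
    · simpa only [exec_support] using (C.exec L u).mem_of_out u v h
    · exact C.mem_of_out u v h

/-- No particle is activable. -/
def Final (L : PortLabelling) (C : Config) : Prop :=
  ∀ p, ¬ C.Activable L p

/-- `C'` is obtained from `C` when a nonempty set of activable particles executes. -/
def Successor (L : PortLabelling) (C C' : Config) : Prop :=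
  ∃ Q : Finset Node, Q.Nonempty ∧ (∀ p ∈ Q, C.Activable L p) ∧ C' = C.fire L Q

/-- `C'` is obtained from `C` when one activable particle executes. -/
def SeqSuccessor (L : PortLabelling) (C C' : Config) : Prop :=
  ∃ p, C.Activable L p ∧ C' = C.fire L {p}

end Config

/-- An execution: infinite, and it repeats a configuration only if no particle is activable. -/
def IsExecution (L : PortLabelling) (S : ℕ → Config) : Prop :=
  ∀ i, (S i).Successor L (S (i + 1)) ∨ ((S i).Final L ∧ S (i + 1) = S i)

/-- A sequential execution: exactly one particle executes in each step from a configuration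
that is not final. -/
def IsSeqExecution (L : PortLabelling) (S : ℕ → Config) : Prop :=
  ∀ i, (S i).SeqSuccessor L (S (i + 1)) ∨ ((S i).Final L ∧ S (i + 1) = S i)

/-- The configuration `C` appears infinitely often in `S`. -/
def InfinitelyOften (S : ℕ → Config) (C : Config) : Prop :=
  ∀ n, ∃ i, n ≤ i ∧ S i = C

/-- A Gouda fair execution. -/
def IsGoudaFairExecution (L : PortLabelling) (S : ℕ → Config) : Prop :=
  IsExecution L S ∧
    ∀ C C', InfinitelyOften S C → C.Successor L C' → InfinitelyOften S C'

/-- A sequential Gouda fair execution. -/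
def IsSeqGoudaFairExecution (L : PortLabelling) (S : ℕ → Config) : Prop :=
  IsSeqExecution L S ∧
    ∀ C C', InfinitelyOften S C → C.SeqSuccessor L C' → InfinitelyOften S C'

end ParticleSystem

namespace ParticleSystem

open Finset

/-! Only finitely many configurations share a support, so some configuration recurs infinitely
often; by fairness, so does everything reachable from it by single executions
(`InfinitelyOften.reach`). It remains to reach, from every configuration, one in which all edges are
directed and R2–R4 hold, and to count its sinks.

The geometric tool is the Euler characteristic χ of the clique complex; `euler` is 6χ, so that it is
a sum over the nodes of integral curvatures 6 - 3d + 2t, where d counts neighbours and t pairs of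
consecutive neighbours. Positive curvature forces the neighbours to form an `Arc`. A nonempty set
without holes has χ ≥ 1, hence a node of this kind (`NoHole.exists_arc`); stripping such nodes one
by one gives χ = 1 for simply connected sets (`euler_eq_six`). On the other hand, charging each edge
to its tail and each triangle to its source identifies χ with the number of sinks
(`euler_eq_card_sinks`). Hence the leader is unique.

For reachability, one execution of each particle makes the configuration `Clean`, which is then
permanent. Undirected edges are confined to a `Closed` set X: particles outside it are idle, and all
edges across its boundary point inwards. X again has no holes, and it can be made smaller
(`exists_reach_smaller`). Otherwise, every particle of X can be brought to a state without outgoing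
edges (`exists_reach_no_claims`). Do this to the middle neighbour of an arc node u of X; then u can
claim all its available edges. From then on, whenever a neighbour gives up its edge to u, u can
claim that edge at once, so the number of edges entering u from X drops until X without u is closed
(`no_center`), a contradiction. -/

/-- The six grid vectors, in cyclic order. -/
def dir (i : ZMod 6) : Node :=
  (![(1, 0), (0, 1), (-1, 1), (-1, 0), (0, -1), (1, -1)] : Fin 6 → Node) i

theorem dir_injective : Function.Injective dir := by
  unfold Function.Injective
  decide

theorem dir_ne_zero : ∀ i, dir i ≠ 0 := by
  decide

theorem dir_add_three : ∀ i, dir i + dir (i + 3) = 0 := by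
  decide

theorem dir_add_two : ∀ i, dir i + dir (i + 2) = dir (i + 1) := by
  decide

theorem dir_sub_dir : ∀ i j k, dir j = dir i + dir k → j = i + 1 ∨ j = i - 1 := by
  decide

theorem adj_iff {p q : Node} : triGrid.Adj p q ↔ ∃ i, q = p + dir i := by
  have h : ∀ v : Node, v ∈ ({(1, 0), (0, 1), (-1, 1), (-1, 0), (0, -1), (1, -1)} : Set Node) ↔
      ∃ i, v = dir i := by
    intro v
    constructor
    · rintro (h | h | h | h | h | h)
      exacts [⟨0, h⟩, ⟨1, h⟩, ⟨2, h⟩, ⟨3, h⟩, ⟨4, h⟩, ⟨5, h⟩]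
    · rintro ⟨i, rfl⟩
      revert i
      simp only [Set.mem_insert_iff, Set.mem_singleton_iff]
      decide
  have := h (q - p)
  simp only [sub_eq_iff_eq_add'] at this
  exact this

theorem adj_dir (p : Node) (i : ZMod 6) : triGrid.Adj p (p + dir i) := adj_iff.2 ⟨i, rfl⟩

theorem eq_add_dir_iff {p q : Node} {i : ZMod 6} : q = p + dir i ↔ p = q + dir (i + 3) := by
  have h := dir_add_three i
  constructor
  · rintro rfl
    rw [add_assoc, h, add_zero]
  · intro e
    rw [e, add_assoc, add_comm (dir (i + 3)), h, add_zero]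

theorem adj_dir_dir {p : Node} {i j : ZMod 6} :
    triGrid.Adj (p + dir i) (p + dir j) ↔ j = i + 1 ∨ j = i - 1 := by
  constructor
  · intro h
    obtain ⟨k, hk⟩ := adj_iff.1 h
    rw [add_assoc] at hk
    exact dir_sub_dir i j k (add_left_cancel hk)
  · rintro (rfl | rfl)
    · rw [← dir_add_two, ← add_assoc]
      exact adj_dir _ _
    · have h := dir_add_two (i - 1)
      have e : i - 1 + 1 = i := by ring
      rw [e] at h
      rw [← h, ← add_assoc]
      exact (adj_dir _ _).symm

/-! ### Arcs in the cyclic order of the six directions -/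

/-- A set of at most three cyclically consecutive elements of `ZMod 6`: it is empty, or it contains
an element `i` such that it is contained in `{i - 1, i, i + 1}`. -/
def Arc (m : ZMod 6 → Prop) : Prop :=
  (∀ i, ¬ m i) ∨ ∃ i, m i ∧ ∀ j, m j → j = i - 1 ∨ j = i ∨ j = i + 1

open Classical in
/-- The number of elements of `m`. -/
noncomputable def count (m : ZMod 6 → Prop) : ℤ := ∑ i, if m i then 1 else 0

open Classical in
/-- The number of pairs of cyclically consecutive elements of `m`. -/
noncomputable def countPairs (m : ZMod 6 → Prop) : ℤ := ∑ i, if m i ∧ m (i + 1) then 1 else 0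

theorem count_eq_bool (b : ZMod 6 → Bool) :
    count (fun i => b i = true) = ∑ i, if b i then 1 else 0 := by
  unfold count
  refine Finset.sum_congr rfl fun i _ => ?_
  split_ifs <;> rfl

theorem countPairs_eq_bool (b : ZMod 6 → Bool) :
    countPairs (fun i => b i = true) = ∑ i, if b i && b (i + 1) then 1 else 0 := by
  unfold countPairs
  refine Finset.sum_congr rfl fun i _ => ?_
  simp only [Bool.and_eq_true]
  split_ifs <;> rfl

theorem exists_bool (m : ZMod 6 → Prop) : ∃ b : ZMod 6 → Bool, m = fun i => b i = true := by
  classical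
  exact ⟨fun i => decide (m i), by simp⟩

-- A finite check over the 64 subsets of `ZMod 6`; the hypothesis is positivity of the curvature of
-- a node with neighbour set `m`.
set_option maxRecDepth 100000 in
theorem arc_of_curvature_pos {m : ZMod 6 → Prop} (h : 0 < 6 - 3 * count m + 2 * countPairs m) :
    Arc m := by
  obtain ⟨b, rfl⟩ := exists_bool m
  rw [count_eq_bool, countPairs_eq_bool] at h
  unfold Arc
  revert h b
  decide +kernel

set_option maxRecDepth 100000 in
theorem Arc.count_eq {m : ZMod 6 → Prop} (h : Arc m) (hne : ∃ i, m i) :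
    count m = countPairs m + 1 := by
  obtain ⟨b, rfl⟩ := exists_bool m
  rw [count_eq_bool, countPairs_eq_bool]
  unfold Arc at h
  revert h hne b
  decide +kernel

theorem count_of_empty {m : ZMod 6 → Prop} (h : ∀ i, ¬ m i) : count m = 0 := by
  simp [count, h]

theorem countPairs_of_empty {m : ZMod 6 → Prop} (h : ∀ i, ¬ m i) : countPairs m = 0 := by
  simp [countPairs, h]

theorem Arc.not_four {m : ZMod 6 → Prop} (h : Arc m) {i : ZMod 6}
    (h₀ : m i) (h₁ : m (i + 1)) (h₂ : m (i + 2)) {j : ZMod 6} (hj : m j) :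
    j = i ∨ j = i + 1 ∨ j = i + 2 := by
  obtain h | ⟨k, -, hk⟩ := h
  · exact absurd h₀ (h i)
  · have a₀ := hk _ h₀
    have a₁ := hk _ h₁
    have a₂ := hk _ h₂
    have a₃ := hk _ hj
    clear hk h₀ h₁ h₂ hj
    revert i j k
    decide +kernel

/-! ### The Euler characteristic of a finite set of nodes -/

/-- The number of directions that lead from `p` to `q` (`0` or `1`). -/
def adjNum (p q : Node) : ℤ := ∑ i, if q = p + dir i then 1 else 0

/-- `1` if `p`, `q`, `r` are the vertices of a triangle in counterclockwise order, else `0`. -/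
def triNum (p q r : Node) : ℤ := ∑ i, if q = p + dir i ∧ r = p + dir (i + 1) then 1 else 0

/-- Six times the Euler characteristic of the clique complex of a finite set of nodes. -/
def euler (X : Finset Node) : ℤ :=
  6 * #X - 3 * (∑ p ∈ X, ∑ q ∈ X, adjNum p q) + 2 * (∑ p ∈ X, ∑ q ∈ X, ∑ r ∈ X, triNum p q r)

theorem adjNum_symm (p q : Node) : adjNum p q = adjNum q p := by
  unfold adjNum
  rw [← Equiv.sum_comp (Equiv.addRight (3 : ZMod 6)) (fun i => if p = q + dir i then (1 : ℤ) else 0)]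
  refine Finset.sum_congr rfl fun i _ => ?_
  exact if_congr eq_add_dir_iff rfl rfl

theorem triNum_rotate (p q r : Node) : triNum p q r = triNum q r p := by
  unfold triNum
  rw [← Equiv.sum_comp (Equiv.addRight (2 : ZMod 6))
    (fun i => if r = q + dir i ∧ p = q + dir (i + 1) then (1 : ℤ) else 0)]
  refine Finset.sum_congr rfl fun i _ => ?_
  have e : i + 2 + 1 = i + 3 := by ring
  simp only [Equiv.coe_addRight, e, ← eq_add_dir_iff]
  by_cases h : q = p + dir i
  · have : q + dir (i + 2) = p + dir (i + 1) := by rw [h, add_assoc, dir_add_two]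
    rw [this]
    simp [h]
  · simp [h]

theorem adjNum_self (p : Node) : adjNum p p = 0 := by
  simp [adjNum, dir_ne_zero]

theorem triNum_self_left (p r : Node) : triNum p p r = 0 := by
  simp [triNum, dir_ne_zero]

theorem adjNum_ne_zero {p q : Node} (h : adjNum p q ≠ 0) : triGrid.Adj p q := by
  obtain ⟨i, -, hi⟩ := Finset.exists_ne_zero_of_sum_ne_zero h
  exact adj_iff.2 ⟨i, by by_contra hc; simp [hc] at hi⟩

theorem triNum_ne_zero {p q r : Node} (h : triNum p q r ≠ 0) :
    triGrid.Adj p q ∧ triGrid.Adj p r ∧ triGrid.Adj q r := by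
  obtain ⟨i, -, hi⟩ := Finset.exists_ne_zero_of_sum_ne_zero h
  have h' : q = p + dir i ∧ r = p + dir (i + 1) := by by_contra hc; simp [hc] at hi
  obtain ⟨rfl, rfl⟩ := h'
  exact ⟨adj_dir _ _, adj_dir _ _, adj_dir_dir.2 (Or.inl rfl)⟩

theorem sum_adjNum_mul (X : Finset Node) (p : Node) (g : Node → ℤ) :
    ∑ q ∈ X, adjNum p q * g q = ∑ i, if p + dir i ∈ X then g (p + dir i) else 0 := by
  simp only [adjNum, Finset.sum_mul, ite_mul, one_mul, zero_mul]
  rw [Finset.sum_comm]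
  simp

theorem sum_triNum_mul (X : Finset Node) (p : Node) (g : Node → Node → ℤ) :
    ∑ q ∈ X, ∑ r ∈ X, triNum p q r * g q r =
      ∑ i, if p + dir i ∈ X ∧ p + dir (i + 1) ∈ X then g (p + dir i) (p + dir (i + 1)) else 0 := by
  simp only [triNum, Finset.sum_mul, ite_mul, one_mul, zero_mul]
  simp_rw [Finset.sum_comm (t := univ)]
  refine Finset.sum_congr rfl fun i _ => ?_
  simp [ite_and]

theorem sum_adjNum (X : Finset Node) (p : Node) :
    ∑ q ∈ X, adjNum p q = count (fun i => p + dir i ∈ X) := by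
  have h := sum_adjNum_mul X p (fun _ => 1)
  simp only [mul_one] at h
  rw [h, count]
  refine Finset.sum_congr rfl fun i _ => ?_
  split_ifs <;> rfl

theorem sum_triNum (X : Finset Node) (p : Node) :
    ∑ q ∈ X, ∑ r ∈ X, triNum p q r = countPairs (fun i => p + dir i ∈ X) := by
  have h := sum_triNum_mul X p (fun _ _ => 1)
  simp only [mul_one] at h
  rw [h, countPairs]
  refine Finset.sum_congr rfl fun i _ => ?_
  split_ifs <;> rfl

theorem euler_eq_sum_curvature (X : Finset Node) :
    euler X = ∑ p ∈ X, (6 - 3 * count (fun i => p + dir i ∈ X) +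
      2 * countPairs (fun i => p + dir i ∈ X)) := by
  simp only [euler, ← sum_adjNum, ← sum_triNum, Finset.sum_add_distrib, Finset.sum_sub_distrib,
    ← Finset.mul_sum, Finset.sum_const]
  simp [mul_comm]

/-- Adding q changes χ by one minus the Euler characteristic of its link, whose vertices and edges
are the neighbours of q and the consecutive pairs of them. -/
theorem euler_insert {X : Finset Node} {q : Node} (hq : q ∉ X) :
    euler (insert q X) = euler X + 6 * (1 - count (fun i => q + dir i ∈ X) +
      countPairs (fun i => q + dir i ∈ X)) := by
  have h₁ : ∑ p ∈ X, adjNum p q = ∑ p ∈ X, adjNum q p :=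
    Finset.sum_congr rfl fun p _ => adjNum_symm p q
  have h₂ : ∑ p ∈ X, ∑ r ∈ X, triNum p q r = ∑ p ∈ X, ∑ r ∈ X, triNum q p r := by
    rw [Finset.sum_comm]
    exact Finset.sum_congr rfl fun r _ => Finset.sum_congr rfl fun p _ => triNum_rotate p q r
  have h₃ : ∑ p ∈ X, ∑ r ∈ X, triNum p r q = ∑ p ∈ X, ∑ r ∈ X, triNum q p r :=
    Finset.sum_congr rfl fun r _ => Finset.sum_congr rfl fun p _ => (triNum_rotate q r p).symm
  have h₄ : ∀ p, triNum q p q = 0 := fun p => by rw [← triNum_rotate, triNum_self_left]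
  have h₅ : ∀ p, triNum p q q = 0 := fun p => by rw [triNum_rotate, triNum_self_left]
  simp only [euler, Finset.sum_insert hq, Finset.card_insert_of_notMem hq, adjNum_self,
    triNum_self_left, Finset.sum_add_distrib, h₁, h₂, h₃, h₄, h₅, Finset.sum_const_zero,
    ← sum_adjNum, ← sum_triNum]
  push_cast
  ring

/-! ### Sets without holes and the lower bound for χ -/

/-- `X` has no holes: from every larger finite set one can leave through a node outside `X`. -/
def NoHole (X : Finset Node) : Prop :=
  ∀ Y : Finset Node, X ⊂ Y → ∃ q ∈ Y, q ∉ X ∧ ∃ z ∉ Y, triGrid.Adj q z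

/-- `S` meets every nonempty union of connected components of `X`. -/
def Covers (X S : Finset Node) : Prop :=
  ∀ A ⊆ X, A.Nonempty → (∀ a ∈ A, ∀ b ∈ X, triGrid.Adj a b → b ∈ A) → ∃ s ∈ S, s ∈ A

/-- The Euler characteristic of `X` is at least the number of its connected components. -/
def EulerBound (X : Finset Node) : Prop :=
  ∃ S, Covers X S ∧ 6 * (#S : ℤ) ≤ euler X

/-- Provides a representative in the component of q: it avoids every union of components that avoids
q. The component `K` is the intersection of all unions of components containing q. -/
theorem exists_mem_component {X S : Finset Node} (h : Covers X S) {q : Node} (hq : q ∈ X) :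
    ∃ s ∈ S, ∀ A ⊆ X, (∀ a ∈ A, ∀ b ∈ X, triGrid.Adj a b → b ∈ A) → q ∉ A → s ∉ A := by
  classical
  let K := X.filter fun x => ∀ A ⊆ X, (∀ a ∈ A, ∀ b ∈ X, triGrid.Adj a b → b ∈ A) → q ∈ A → x ∈ A
  obtain ⟨s, hs, hsK⟩ := h K (filter_subset _ _) ⟨q, by simp [K, hq]⟩ (by
    intro a ha b hb hab
    simp only [K, mem_filter] at ha ⊢
    exact ⟨hb, fun A hA hc hqA => hc a (ha.2 A hA hc hqA) b hb hab⟩)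
  refine ⟨s, hs, fun A hA hc hqA hsA => ?_⟩
  have := (mem_filter.1 hsK).2 (X \ A) sdiff_subset (by
    intro a ha b hb hab
    rw [mem_sdiff] at ha ⊢
    exact ⟨hb, fun hbA => ha.2 (hc b hbA a ha.1 hab.symm)⟩) (by simp [hq, hqA])
  exact (mem_sdiff.1 this).2 hsA

-- Each maximal run of `m` has one element more than consecutive pairs, and one start; the full
-- circle has no start and difference 0.
open Classical in
theorem card_arc_starts (m : ZMod 6 → Prop) :
    (#(univ.filter fun i => m i ∧ ¬ m (i - 1)) : ℤ) = count m - countPairs m := by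
  unfold count countPairs
  rw [Finset.card_filter,
    ← Equiv.sum_comp (Equiv.subRight (1 : ZMod 6)) (fun i => if m i ∧ m (i + 1) then (1 : ℤ) else 0),
    ← Finset.sum_sub_distrib]
  push_cast
  refine Finset.sum_congr rfl fun i _ => ?_
  simp only [Equiv.subRight_apply, sub_add_cancel]
  by_cases h₁ : m i <;> by_cases h₂ : m (i - 1) <;> simp [h₁, h₂]

/-- As z is missing, the neighbours of q form runs around q, and removing q raises χ by their number
minus one. The component of q splits into at most that many pieces, so its representative is traded
for the starts of the runs. -/
theorem EulerBound.erase {X : Finset Node} (h : EulerBound X) {q z : Node} (hq : q ∈ X)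
    (hz : z ∉ X) (hqz : triGrid.Adj q z) : EulerBound (X.erase q) := by
  classical
  obtain ⟨S, hS, hle⟩ := h
  obtain ⟨s₀, hs₀, hcomp⟩ := exists_mem_component hS hq
  set m : ZMod 6 → Prop := fun i => q + dir i ∈ X.erase q with hm
  set T := univ.filter fun i => m i ∧ ¬ m (i - 1) with hT
  refine ⟨S.erase s₀ ∪ T.image fun i => q + dir i, ?_, ?_⟩
  · intro A hA hne hc
    by_cases hnb : ∃ i, q + dir i ∈ A
    · obtain ⟨i, hi⟩ := hnb
      by_contra hcon
      have key : ∀ j, q + dir j ∈ A → q + dir (j - 1) ∈ A := by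
        intro j hj
        by_contra hj'
        refine hcon ⟨q + dir j, ?_, hj⟩
        refine mem_union_right _ (mem_image_of_mem _ ?_)
        simp only [hT, mem_filter, mem_univ, true_and]
        exact ⟨hA hj, fun hj'' => hj' (hc _ hj _ hj'' (adj_dir_dir.2 (Or.inr rfl)))⟩
      -- If A contained no start of a run, walking backwards around q would never leave A and would
      -- eventually hit z.
      have all : ∀ n : ℕ, q + dir (i - n) ∈ A := by
        intro n
        induction n with
        | zero => simpa using hi
        | succ n ih =>
          have := key _ ih
          rwa [sub_sub, ← Nat.cast_succ] at this
      obtain ⟨k, rfl⟩ := adj_iff.1 hqz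
      have hk := all (i - k).val
      rw [ZMod.natCast_zmod_val, sub_sub_cancel] at hk
      exact hz (mem_of_mem_erase (hA hk))
    · have hAX : A ⊆ X := hA.trans (erase_subset _ _)
      have hc' : ∀ a ∈ A, ∀ b ∈ X, triGrid.Adj a b → b ∈ A := by
        intro a ha b hb hab
        by_cases hbq : b = q
        · subst hbq
          obtain ⟨i, rfl⟩ := adj_iff.1 hab.symm
          exact absurd ⟨i, ha⟩ hnb
        · exact hc a ha b (mem_erase.2 ⟨hbq, hb⟩) hab
      obtain ⟨s, hs, hsA⟩ := hS A hAX hne hc'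
      have hqA : q ∉ A := fun h => (mem_erase.1 (hA h)).1 rfl
      refine ⟨s, mem_union_left _ (mem_erase.2 ⟨?_, hs⟩), hsA⟩
      rintro rfl
      exact hcomp A hAX hc' hqA hsA
  · have e := euler_insert (notMem_erase q X)
    rw [insert_erase hq] at e
    have c : (#T : ℤ) = count m - countPairs m := by
      rw [← card_arc_starts m, hT]
      congr!
    have c₁ := card_union_le (S.erase s₀) (T.image fun i => q + dir i)
    have c₂ : #(T.image fun i => q + dir i) ≤ #T := card_image_le
    have c₃ := card_erase_add_one hs₀
    have c₄ : #(S.erase s₀ ∪ T.image fun i => q + dir i) + 1 ≤ #S + #T := by omega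
    have c₅ : (#(S.erase s₀ ∪ T.image fun i => q + dir i) : ℤ) + 1 ≤ #S + #T := by
      exact_mod_cast c₄
    rw [← hm] at e
    linarith

theorem EulerBound.insert {X : Finset Node} (h : EulerBound X) {q : Node} (hq : q ∉ X)
    (harc : Arc fun i => q + dir i ∈ X) {i : ZMod 6} (hi : q + dir i ∈ X) :
    EulerBound (insert q X) := by
  obtain ⟨S, hS, hle⟩ := h
  refine ⟨S, ?_, ?_⟩
  · intro A hA hne hc
    have hX : A.erase q ⊆ X := by
      intro a ha
      rw [mem_erase] at ha
      exact (mem_insert.1 (hA ha.2)).resolve_left ha.1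
    have hne' : (A.erase q).Nonempty := by
      by_cases hqA : q ∈ A
      · refine ⟨q + dir i, mem_erase.2 ⟨?_, hc q hqA _ (mem_insert_of_mem hi) (adj_dir _ _)⟩⟩
        intro h
        exact hq (h ▸ hi)
      · rwa [erase_eq_of_notMem hqA]
    obtain ⟨s, hs, hsA⟩ := hS _ hX hne' (by
      intro a ha b hb hab
      refine mem_erase.2 ⟨?_, hc a (mem_of_mem_erase ha) b (mem_insert_of_mem hb) hab⟩
      rintro rfl
      exact hq hb)
    exact ⟨s, hs, mem_of_mem_erase hsA⟩
  · rw [euler_insert hq, harc.count_eq ⟨i, hi⟩]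
    linarith

theorem eulerBound_singleton (q : Node) : EulerBound {q} := by
  refine ⟨{q}, ?_, ?_⟩
  · intro A hA hne _
    exact ⟨q, mem_singleton_self q, by rw [Finset.Nonempty.subset_singleton_iff hne |>.1 hA]; simp⟩
  · have h := euler_insert (notMem_empty q)
    rw [count_of_empty (by simp), countPairs_of_empty (by simp)] at h
    have e : insert q (∅ : Finset Node) = {q} := rfl
    rw [e] at h
    rw [h]
    simp [euler]

/-! ### Large parallelograms, built node by node -/

/-- The columns `c, …, a` of height `n - c + 1`, the last one cut off above `b`. -/
noncomputable def stair (c n a b : ℤ) : Finset Node :=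
  (Icc c a ×ˢ Icc c n).filter fun x => x.1 < a ∨ x.2 ≤ b

theorem mem_stair {c n a b : ℤ} {x : Node} :
    x ∈ stair c n a b ↔ (c ≤ x.1 ∧ x.1 ≤ a) ∧ (c ≤ x.2 ∧ x.2 ≤ n) ∧ (x.1 < a ∨ x.2 ≤ b) := by
  simp [stair, and_assoc]

theorem dir_values : dir 0 = (1, 0) ∧ dir 1 = (0, 1) ∧ dir 2 = (-1, 1) ∧ dir 3 = (-1, 0) ∧
    dir 4 = (0, -1) ∧ dir 5 = (1, -1) := by
  decide

theorem forall_zmod_six {m : ZMod 6 → Prop} :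
    (∀ i, m i) ↔ m 0 ∧ m 1 ∧ m 2 ∧ m 3 ∧ m 4 ∧ m 5 := by
  constructor
  · intro h
    exact ⟨h 0, h 1, h 2, h 3, h 4, h 5⟩
  · rintro ⟨h₀, h₁, h₂, h₃, h₄, h₅⟩ i
    change Fin 6 at i
    fin_cases i <;> assumption

theorem eulerBound_stair_succ {c n a b : ℤ} (hca : c ≤ a) (hcb : c ≤ b) (hbn : b + 1 ≤ n)
    (h : EulerBound (stair c n a b)) : EulerBound (stair c n a (b + 1)) := by
  obtain ⟨d₀, d₁, d₂, d₃, d₄, d₅⟩ := dir_values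
  have e : stair c n a (b + 1) = insert (a, b + 1) (stair c n a b) := by
    ext ⟨x, y⟩
    simp only [mem_stair, mem_insert, Prod.mk.injEq]
    omega
  rw [e]
  have h4 : ((a, b + 1) : Node) + dir 4 ∈ stair c n a b := by
    simp only [d₄, mem_stair, Prod.mk_add_mk]
    omega
  -- The neighbours already present lie in directions 2, 3, 4, with only 4 in the first column;
  -- hence the two choices of the middle.
  refine h.insert (by simp [mem_stair]) (Or.inr ?_) h4
  obtain rfl | hlt := hca.eq_or_lt
  · refine ⟨4, h4, ?_⟩
    rw [forall_zmod_six]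
    simp only [d₀, d₁, d₂, d₃, d₄, d₅, mem_stair, Prod.mk_add_mk]
    refine ⟨?_, ?_, ?_, ?_, ?_, ?_⟩ <;> intro h <;> first | omega | decide
  · refine ⟨3, by simp only [d₃, mem_stair, Prod.mk_add_mk]; omega, ?_⟩
    rw [forall_zmod_six]
    simp only [d₀, d₁, d₂, d₃, d₄, d₅, mem_stair, Prod.mk_add_mk]
    refine ⟨?_, ?_, ?_, ?_, ?_, ?_⟩ <;> intro h <;> first | omega | decide

theorem eulerBound_stair_next {c n a : ℤ} (hca : c ≤ a) (hcn : c ≤ n)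
    (h : EulerBound (stair c n a n)) : EulerBound (stair c n (a + 1) c) := by
  obtain ⟨d₀, d₁, d₂, d₃, d₄, d₅⟩ := dir_values
  have e : stair c n (a + 1) c = insert (a + 1, c) (stair c n a n) := by
    ext ⟨x, y⟩
    simp only [mem_stair, mem_insert, Prod.mk.injEq]
    omega
  rw [e]
  have h3 : ((a + 1, c) : Node) + dir 3 ∈ stair c n a n := by
    simp only [d₃, mem_stair, Prod.mk_add_mk]
    omega
  refine h.insert (by simp [mem_stair]) (Or.inr ⟨3, h3, ?_⟩) h3
  rw [forall_zmod_six]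
  simp only [d₀, d₁, d₂, d₃, d₄, d₅, mem_stair, Prod.mk_add_mk]
  refine ⟨?_, ?_, ?_, ?_, ?_, ?_⟩ <;> intro h <;> first | omega | decide

theorem eulerBound_stair {c n a : ℤ} (hcn : c ≤ n) (hca : c ≤ a) : EulerBound (stair c n a n) := by
  have up : ∀ a, c ≤ a → EulerBound (stair c n a c) → ∀ b, c ≤ b → b ≤ n →
      EulerBound (stair c n a b) := by
    intro a ha h b hb
    induction b, hb using Int.leInduction with
    | base => exact fun _ => h
    | succ b hb ih => exact fun hbn => eulerBound_stair_succ ha hb hbn (ih (by omega))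
  refine up a hca ?_ n hcn le_rfl
  induction a, hca using Int.leInduction with
  | base =>
    convert eulerBound_singleton (c, c) using 1
    ext ⟨x, y⟩
    simp only [mem_stair, mem_singleton, Prod.mk.injEq]
    omega
  | succ a ha ih => exact eulerBound_stair_next ha hcn (up a ha ih n hcn le_rfl)

theorem exists_eulerBound_superset (X : Finset Node) : ∃ Y, X ⊆ Y ∧ EulerBound Y := by
  let N : ℕ := X.sup fun x => x.1.natAbs + x.2.natAbs
  refine ⟨stair (-N) N N N, fun x hx => ?_, eulerBound_stair (by omega) (by omega)⟩
  have h : x.1.natAbs + x.2.natAbs ≤ N :=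
    Finset.le_sup (f := fun x : Node => x.1.natAbs + x.2.natAbs) hx
  rw [mem_stair]
  omega

/-- Start from a large parallelogram around X and carve away nodes outside X from the boundary; the
absence of holes keeps this going until X is left. -/
theorem NoHole.eulerBound {X : Finset Node} (hX : NoHole X) : EulerBound X := by
  obtain ⟨Y, hXY, hY⟩ := exists_eulerBound_superset X
  induction Y using Finset.strongInduction with
  | H Y ih =>
    obtain rfl | hss := hXY.eq_or_ssubset
    · exact hY
    · obtain ⟨q, hq, hqX, z, hz, hqz⟩ := hX Y hss
      exact ih _ (erase_ssubset hq) (subset_erase.2 ⟨hXY, hqX⟩) (hY.erase hq hz hqz)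

theorem NoHole.exists_arc {X : Finset Node} (hX : NoHole X) (hne : X.Nonempty) :
    ∃ u ∈ X, Arc fun i => u + dir i ∈ X := by
  obtain ⟨S, hS, hle⟩ := hX.eulerBound
  obtain ⟨s, hs, -⟩ := hS X Subset.rfl hne fun _ _ b hb _ => hb
  have : 0 < #S := card_pos.2 ⟨s, hs⟩
  have hpos : 0 < euler X := by omega
  rw [euler_eq_sum_curvature] at hpos
  obtain ⟨u, hu, h⟩ := exists_lt_of_sum_lt (f := fun _ => (0 : ℤ)) (by simpa using hpos)
  exact ⟨u, hu, arc_of_curvature_pos h⟩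

theorem Arc.exists_not {m : ZMod 6 → Prop} (h : Arc m) : ∃ i, ¬ m i := by
  obtain h | ⟨i, -, hi⟩ := h
  · exact ⟨0, h 0⟩
  · refine ⟨i + 3, fun h => ?_⟩
    have := hi _ h
    clear hi h
    revert i
    decide

/-- A larger set Y either is X itself, and then u is the exit towards z, or it has an exit because
`insert u Y` strictly contains X. -/
theorem NoHole.erase {X : Finset Node} (hX : NoHole X) {u z : Node} (hu : u ∈ X) (hz : z ∉ X)
    (huz : triGrid.Adj u z) : NoHole (X.erase u) := by
  intro Y hY
  have hsub := hY.1
  obtain ⟨y, hyY, hy⟩ := (ssubset_iff_of_subset hsub).1 hY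
  have hXu : X ⊆ insert u Y := by
    intro x hx
    by_cases h : x = u
    · exact h ▸ mem_insert_self u Y
    · exact mem_insert_of_mem (hsub (mem_erase.2 ⟨h, hx⟩))
  obtain e | hss := hXu.eq_or_ssubset
  · have huY : u ∈ Y := by
      by_contra h
      refine hy (mem_erase.2 ⟨?_, e ▸ mem_insert_of_mem hyY⟩)
      rintro rfl
      exact h hyY
    exact ⟨u, huY, notMem_erase u X, z, fun h => hz (e ▸ mem_insert_of_mem h), huz⟩
  · obtain ⟨q, hq, hqX, w, hw, hqw⟩ := hX _ hss
    refine ⟨q, ?_, fun h => hqX (mem_of_mem_erase h), w, fun h => hw (mem_insert_of_mem h), hqw⟩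
    obtain rfl | h := mem_insert.1 hq
    · exact absurd hu hqX
    · exact h

/-! ### Connected sets without holes have χ = 1 -/

/-- `X` is connected: each nonempty proper subset has an edge to the rest. -/
def NoCut (X : Finset Node) : Prop :=
  ∀ A ⊆ X, A.Nonempty → A ≠ X → ∃ a ∈ A, ∃ b ∈ X, b ∉ A ∧ triGrid.Adj a b

/-- All other neighbours of u are adjacent to the middle of the arc, so they stay connected without
u. -/
theorem NoCut.erase {X : Finset Node} (hX : NoCut X) {u : Node} (hu : u ∈ X)
    (harc : Arc fun i => u + dir i ∈ X) : NoCut (X.erase u) := by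
  intro A hA hne hAX
  have huA : u ∉ A := fun h => notMem_erase u X (hA h)
  have hAX' : A ⊆ X := hA.trans (erase_subset _ _)
  by_contra! hcon
  have hA' : A ≠ X := by
    rintro rfl
    exact huA hu
  have hB' : insert u A ≠ X := by
    intro h
    apply hAX
    rw [← h, erase_insert huA]
  have h₁ : ∃ a ∈ A, triGrid.Adj u a := by
    obtain ⟨a, ha, b, hb, hbA, hab⟩ := hX A hAX' hne hA'
    by_cases h : b = u
    · exact ⟨a, ha, h ▸ hab.symm⟩
    · exact absurd hab (hcon a ha b (mem_erase.2 ⟨h, hb⟩) hbA)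
  have h₂ : ∃ b ∈ X, b ∉ A ∧ triGrid.Adj u b := by
    obtain ⟨a, ha, b, hb, hbA, hab⟩ :=
      hX (insert u A) (insert_subset hu hAX') (insert_nonempty _ _) hB'
    rw [mem_insert, not_or] at hbA
    obtain rfl | ha := mem_insert.1 ha
    · exact ⟨b, hb, hbA.2, hab⟩
    · exact absurd hab (hcon a ha b (mem_erase.2 ⟨hbA.1, hb⟩) hbA.2)
  obtain ⟨a, ha, hua⟩ := h₁
  obtain ⟨b, hb, hbA, hub⟩ := h₂
  obtain ⟨i, rfl⟩ := adj_iff.1 hua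
  obtain ⟨j, rfl⟩ := adj_iff.1 hub
  have hj : u + dir j ∈ X.erase u := mem_erase.2 ⟨hub.ne', hb⟩
  obtain h | ⟨k, hk, hall⟩ := harc
  · exact h j hb
  have adj : ∀ l, u + dir l ∈ X → l = k ∨ triGrid.Adj (u + dir k) (u + dir l) := by
    intro l hl
    rw [adj_dir_dir]
    have := hall l hl
    tauto
  by_cases hkA : u + dir k ∈ A
  · obtain rfl | h := adj j hb
    · exact hbA hkA
    · exact hcon _ hkA _ hj hbA h
  · obtain rfl | h := adj i (hAX' ha)
    · exact hkA ha
    · exact hcon _ ha _ (mem_erase.2 ⟨(adj_dir u k).ne', hk⟩) hkA h.symm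

theorem euler_eq_six {X : Finset Node} (hne : X.Nonempty) (hX : NoHole X) (hX' : NoCut X) :
    euler X = 6 := by
  induction X using Finset.strongInduction with
  | H X ih =>
    obtain ⟨u, hu, harc⟩ := hX.exists_arc hne
    have e := euler_insert (notMem_erase u X)
    rw [insert_erase hu] at e
    have hm : (fun i => u + dir i ∈ X.erase u) = fun i => u + dir i ∈ X := by
      ext i
      simp [dir_ne_zero]
    rw [hm] at e
    by_cases hu' : X = {u}
    · have hempty : ∀ i, ¬ u + dir i ∈ X := by
        simp [hu', dir_ne_zero]
      rw [e, count_of_empty hempty, countPairs_of_empty hempty, hu']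
      simp [euler]
    · obtain ⟨a, ha, b, hb, hba, hab⟩ := hX' {u} (singleton_subset_iff.2 hu)
        (singleton_nonempty u) (Ne.symm hu')
      obtain rfl := mem_singleton.1 ha
      obtain ⟨i, rfl⟩ := adj_iff.1 hab
      rw [e, harc.count_eq ⟨i, hb⟩]
      obtain ⟨j, hj⟩ := harc.exists_not
      rw [ih _ (erase_ssubset hu) ⟨_, mem_erase.2 ⟨hab.ne', hb⟩⟩ (hX.erase hu hj (adj_dir _ _))
        (hX'.erase hu harc)]
      ring

/-! ### Orientations with consecutive outgoing edges -/

/-- A finite region cannot have all its boundary edges outgoing, if the edges inside the region are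
directed and the outgoing edges of each node are consecutive and at most three. -/
theorem no_outward_region {O : Node → Node → Prop} {W : Finset Node} (hne : W.Nonempty)
    (harc : ∀ w ∈ W, Arc fun i => O w (w + dir i))
    (hbd : ∀ w ∈ W, ∀ i, w + dir i ∈ W ∨ O w (w + dir i))
    (hdir : ∀ w ∈ W, ∀ w' ∈ W, triGrid.Adj w w' → O w w' ∨ O w' w) : False := by
  induction W using Finset.strongInduction with
  | H W ih =>
    obtain ⟨d₀, d₁, d₂, d₃, d₄, d₅⟩ := dir_values
    obtain ⟨w, hw, hmax⟩ := W.exists_max_image (fun x : Node => toLex x) hne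
    -- At the lexicographically largest node w, directions 5, 0, 1 leave W and use up the whole arc.
    -- So direction 3 stays inside, every edge from w into W is incoming, and W without w satisfies
    -- the same hypotheses.
    have out : ∀ i, toLex w < toLex (w + dir i) → w + dir i ∉ W := fun i h h' =>
      absurd (hmax _ h') (not_le.2 h)
    have h₀ : w + dir 0 ∉ W := out 0 (by rw [d₀, Prod.Lex.toLex_lt_toLex]; simp)
    have h₁ : w + dir 1 ∉ W := out 1 (by rw [d₁, Prod.Lex.toLex_lt_toLex]; simp)
    have h₅ : w + dir 5 ∉ W := out 5 (by rw [d₅, Prod.Lex.toLex_lt_toLex]; simp)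
    have only : ∀ i, w + dir i ∈ W → ¬ O w (w + dir i) := by
      intro i hi ho
      have := (harc w hw).not_four (i := 5) ((hbd w hw 5).resolve_left h₅)
        ((hbd w hw 0).resolve_left h₀) ((hbd w hw 1).resolve_left h₁) ho
      obtain rfl | rfl | rfl := this
      exacts [h₅ hi, h₀ hi, h₁ hi]
    have h₃ : w + dir 3 ∈ W := by
      by_contra h
      have := (harc w hw).not_four (i := 5) ((hbd w hw 5).resolve_left h₅)
        ((hbd w hw 0).resolve_left h₀) ((hbd w hw 1).resolve_left h₁) ((hbd w hw 3).resolve_left h)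
      revert this
      decide
    refine ih (W.erase w) (erase_ssubset hw) ⟨_, mem_erase.2 ⟨(adj_dir w 3).ne', h₃⟩⟩
      (fun v hv => harc v (mem_of_mem_erase hv)) ?_
      (fun v hv v' hv' => hdir v (mem_of_mem_erase hv) v' (mem_of_mem_erase hv'))
    intro v hv i
    have hvW := mem_of_mem_erase hv
    by_cases h : v + dir i = w
    · right
      rw [h]
      obtain e := eq_add_dir_iff.1 h.symm
      rw [e] at hvW ⊢
      exact (hdir w hw _ hvW (adj_dir _ _)).resolve_left (only _ hvW)
    · obtain h' | h' := hbd v hvW i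
      · exact Or.inl (mem_erase.2 ⟨h, h'⟩)
      · exact Or.inr h'

open Classical in
/-- The number of sinks of an orientation with consecutive outgoing edges and without directed
triangles is the Euler characteristic. -/
theorem euler_eq_card_sinks {O : Node → Node → Prop} {X : Finset Node}
    (hmem : ∀ p q, O p q → q ∈ X)
    (hdir : ∀ p ∈ X, ∀ q ∈ X, triGrid.Adj p q → O p q ∨ O q p)
    (hasymm : ∀ p q, O p q → ¬ O q p)
    (hadj : ∀ p q, O p q → triGrid.Adj p q)
    (htri : ∀ p q r, ¬ (O p q ∧ O q r ∧ O r p))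
    (harc : ∀ p ∈ X, Arc fun i => O p (p + dir i)) :
    euler X = 6 * #(X.filter fun p => ∀ q, ¬ O p q) := by
  let o : Node → Node → ℤ := fun p q => if O p q then 1 else 0
  let s : Node → Node → Node → ℤ := fun p q r => o p q * o p r
  have hA : ∑ p ∈ X, ∑ q ∈ X, adjNum p q = 2 * ∑ p ∈ X, ∑ q ∈ X, adjNum p q * o p q := by
    have h₁ : ∑ p ∈ X, ∑ q ∈ X, adjNum p q =
        ∑ p ∈ X, ∑ q ∈ X, (adjNum p q * o p q + adjNum p q * o q p) := by
      refine sum_congr rfl fun p hp => sum_congr rfl fun q hq => ?_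
      by_cases h : adjNum p q = 0
      · simp [h]
      · obtain h' | h' := hdir p hp q hq (adjNum_ne_zero h)
        · simp [o, h', hasymm _ _ h']
        · simp [o, h', hasymm _ _ h']
    have h₂ : ∑ p ∈ X, ∑ q ∈ X, adjNum p q * o q p = ∑ p ∈ X, ∑ q ∈ X, adjNum p q * o p q := by
      rw [sum_comm]
      exact sum_congr rfl fun p _ => sum_congr rfl fun q _ => by rw [adjNum_symm]
    simp only [h₁, sum_add_distrib, h₂]
    ring
  -- A triangle that is not a directed cycle has exactly one vertex from which both its edges go
  -- out; `s` picks it. The factor 3 comes from the rotations of the triangle.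
  have hT : ∑ p ∈ X, ∑ q ∈ X, ∑ r ∈ X, triNum p q r =
      3 * ∑ p ∈ X, ∑ q ∈ X, ∑ r ∈ X, triNum p q r * s p q r := by
    have h₁ : ∑ p ∈ X, ∑ q ∈ X, ∑ r ∈ X, triNum p q r = ∑ p ∈ X, ∑ q ∈ X, ∑ r ∈ X,
        (triNum p q r * s p q r + triNum p q r * s q r p + triNum p q r * s r p q) := by
      refine sum_congr rfl fun p hp => sum_congr rfl fun q hq => sum_congr rfl fun r hr => ?_
      by_cases h : triNum p q r = 0
      · simp [h]
      · obtain ⟨a₁, a₂, a₃⟩ := triNum_ne_zero h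
        have c₁ := htri p q r
        have c₂ := htri p r q
        have b₁ := hasymm p q
        have b₂ := hasymm p r
        have b₃ := hasymm q r
        obtain h₁ | h₁ := hdir p hp q hq a₁ <;> obtain h₂ | h₂ := hdir p hp r hr a₂ <;>
          obtain h₃ | h₃ := hdir q hq r hr a₃ <;>
          simp_all [o, s]
    have rot : ∀ f : Node → Node → Node → ℤ,
        ∑ p ∈ X, ∑ q ∈ X, ∑ r ∈ X, f q r p = ∑ p ∈ X, ∑ q ∈ X, ∑ r ∈ X, f p q r := by
      intro f
      rw [sum_comm]
      exact sum_congr rfl fun q _ => sum_comm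
    have h₂ := rot fun p q r => triNum p q r * s p q r
    have h₃ := rot fun p q r => triNum r p q * s r p q
    simp only [← triNum_rotate] at h₂
    simp only [fun p q r => (triNum_rotate r p q)] at h₃
    simp only [h₁, sum_add_distrib, h₂, ← h₃]
    ring
  have hsum : euler X = 6 * ∑ p ∈ X, (1 - ∑ q ∈ X, adjNum p q * o p q +
      ∑ q ∈ X, ∑ r ∈ X, triNum p q r * s p q r) := by
    rw [euler, hA, hT, sum_add_distrib, sum_sub_distrib]
    simp only [sum_const, nsmul_eq_mul, mul_one]
    ring
  rw [hsum, card_filter]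
  push_cast
  congr 1
  refine sum_congr rfl fun p hp => ?_
  have hd : ∑ q ∈ X, adjNum p q * o p q = count fun i => O p (p + dir i) := by
    rw [sum_adjNum_mul, count]
    refine sum_congr rfl fun i _ => ?_
    by_cases h : O p (p + dir i)
    · simp [o, h, hmem _ _ h]
    · simp [o, h]
  have ht : ∑ q ∈ X, ∑ r ∈ X, triNum p q r * s p q r = countPairs fun i => O p (p + dir i) := by
    rw [sum_triNum_mul, countPairs]
    refine sum_congr rfl fun i _ => ?_
    by_cases h : O p (p + dir i)
    · by_cases h' : O p (p + dir (i + 1))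
      · simp [o, s, h, h', hmem _ _ h, hmem _ _ h']
      · simp [o, s, h']
    · simp [o, s, h]
  rw [hd, ht]
  by_cases hs : ∀ q, ¬ O p q
  · rw [count_of_empty fun i => hs _, countPairs_of_empty fun i => hs _]
    simp [hs]
  · rw [if_neg hs]
    push Not at hs
    obtain ⟨q, hq⟩ := hs
    obtain ⟨i, rfl⟩ := adj_iff.1 (hadj _ _ hq)
    rw [(harc p hp).count_eq ⟨i, hq⟩]
    ring

/-! ### Outgoing edges at consecutive ports -/

theorem Arc.comp_affine {m : ZMod 6 → Prop} {f : ZMod 6 → ZMod 6} {c : ZMod 6}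
    (hf : (∀ j, f j = c + j) ∨ ∀ j, f j = c - j) : Arc (fun j => m (f j)) ↔ Arc m := by
  have hinv : ∃ g : ZMod 6 → ZMod 6, ∀ k, f (g k) = k := by
    obtain hf | hf := hf
    · exact ⟨fun k => k - c, fun k => by rw [hf]; ring⟩
    · exact ⟨fun k => c - k, fun k => by rw [hf]; ring⟩
  obtain ⟨g, hg⟩ := hinv
  have hstep : ∀ i j, (j = i - 1 ∨ j = i ∨ j = i + 1) ↔
      (f j = f i - 1 ∨ f j = f i ∨ f j = f i + 1) := by
    intro i j
    obtain hf | hf := hf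
    · simp only [hf]
      clear hf hg
      revert c i j
      decide +kernel
    · simp only [hf]
      clear hf hg
      revert c i j
      decide +kernel
  constructor
  · rintro (h | ⟨i, hi, h⟩)
    · exact Or.inl fun k hk => h (g k) (by simpa only [hg] using hk)
    · refine Or.inr ⟨f i, hi, fun k hk => ?_⟩
      have := (hstep i (g k)).1 (h (g k) (by simpa only [hg] using hk))
      rwa [hg] at this
  · rintro (h | ⟨i, hi, h⟩)
    · exact Or.inl fun k hk => h _ hk
    · refine Or.inr ⟨g i, by simpa only [hg] using hi, fun k hk => ?_⟩
      rw [hstep, hg]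
      exact h _ hk

/-- Consecutive ports differ by one step in direction, and injectivity forbids turning back, so the
sense of rotation is constant. -/
theorem PortLabelling.exists_affine (L : PortLabelling) (p : Node) :
    ∃ (f : ZMod 6 → ZMod 6) (c : ZMod 6), (∀ j, (L.port p j : Node) = p + dir (f j)) ∧
      ((∀ j, f j = c + j) ∨ ∀ j, f j = c - j) := by
  choose f hf using fun j => adj_iff.1 (L.port p j).2
  have hinj : Function.Injective f := by
    intro i j h
    apply (L.port p).injective
    apply Subtype.ext
    rw [hf, hf, h]
  have hstep : ∀ j, f (j + 1) = f j + 1 ∨ f (j + 1) = f j - 1 := by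
    intro j
    have := L.consecutive p j
    rwa [hf, hf, adj_dir_dir] at this
  have hne : ∀ j, f (j + 1 + 1) ≠ f j := by
    intro j h
    have := hinj h
    clear h
    revert j
    decide
  have ind : ∀ e : ZMod 6, (∀ j, f (j + 1) = f j + e) → ∀ j, f j = f 0 + e * j := by
    intro e he j
    have : ∀ n : ℕ, f n = f 0 + e * n := by
      intro n
      induction n with
      | zero => simp
      | succ n ih =>
        push_cast
        rw [he, ih]
        ring
    have := this j.val
    rwa [ZMod.natCast_zmod_val] at this
  have prop : ∀ e : ZMod 6, f (0 + 1) = f 0 + e → (∀ j, f (j + 1) = f j + e →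
      f (j + 1 + 1) = f (j + 1) + e) → ∀ j, f (j + 1) = f j + e := by
    intro e h0 h j
    have : ∀ n : ℕ, f (n + 1) = f n + e := by
      intro n
      induction n with
      | zero => simpa using h0
      | succ n ih =>
        push_cast
        exact h _ ih
    have := this j.val
    rwa [ZMod.natCast_zmod_val] at this
  refine ⟨f, f 0, hf, ?_⟩
  obtain h0 | h0 := hstep 0
  · left
    intro j
    rw [ind 1 (prop 1 h0 ?_) j, one_mul]
    intro j hj
    refine (hstep (j + 1)).resolve_right fun h => hne j ?_
    rw [h, hj]
    ring
  · right
    intro j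
    rw [ind (-1) (prop (-1) (by rw [h0]; ring) ?_) j]
    · ring
    intro j hj
    rw [← sub_eq_add_neg]
    refine (hstep (j + 1)).resolve_left fun h => hne j ?_
    rw [h, hj]
    ring

set_option maxRecDepth 100000 in
theorem Arc.exists_interval {m : ZMod 6 → Prop} (h : Arc m) :
    ∃ i, ∃ k < 4, ∀ j, m j ↔ ∃ l : ℕ, l < k ∧ j = i + (l : ZMod 6) := by
  obtain ⟨b, rfl⟩ := exists_bool m
  unfold Arc at h
  revert h b
  decide +kernel

theorem arc_iff_interval {m : ZMod 6 → Prop} :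
    Arc m ↔ {j | m j}.ncard ≤ 3 ∧
      ∃ (i : ZMod 6) (k : ℕ), ∀ j, m j ↔ ∃ l : ℕ, l < k ∧ j = i + (l : ZMod 6) := by
  constructor
  · intro h
    refine ⟨?_, ?_⟩
    · obtain h | ⟨i, -, hi⟩ := h
      · simp [h]
      · refine (Set.ncard_le_ncard (t := (({i - 1, i, i + 1} : Finset (ZMod 6)) : Set (ZMod 6)))
          (fun j hj => by simpa using hi j hj) (Finset.finite_toSet _)).trans ?_
        rw [Set.ncard_coe_finset]
        exact card_le_three
    · obtain ⟨i, k, -, h⟩ := h.exists_interval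
      exact ⟨i, k, h⟩
  · rintro ⟨hc, i, k, h⟩
    have hmem : ∀ l : ℕ, l < k → m (i + (l : ZMod 6)) := fun l hl => (h _).2 ⟨l, hl, rfl⟩
    by_cases hk : k < 4
    · obtain rfl | hk0 := Nat.eq_zero_or_pos k
      · exact Or.inl fun j hj => by simpa using (h j).1 hj
      · right
        -- An interval of length 3 must be centred at its second element; a shorter one may be
        -- centred at its first.
        obtain rfl | hk3 : k = 3 ∨ k < 3 := by omega
        · refine ⟨i + 1, by simpa using hmem 1 (by norm_num), fun j hj => ?_⟩
          obtain ⟨l, hl, rfl⟩ := (h j).1 hj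
          clear h hc hj hmem
          interval_cases l <;> revert i <;> decide
        · refine ⟨i, by simpa using hmem 0 hk0, fun j hj => ?_⟩
          obtain ⟨l, hl, rfl⟩ := (h j).1 hj
          have hl' : l < 2 := by omega
          clear h hc hj hmem hl
          interval_cases l <;> revert i <;> decide
    · exfalso
      have hsub : (({i, i + 1, i + 2, i + 3} : Finset (ZMod 6)) : Set (ZMod 6)) ⊆ {j | m j} := by
        intro j hj
        simp only [coe_insert, coe_singleton, Set.mem_insert_iff, Set.mem_singleton_iff] at hj
        obtain rfl | rfl | rfl | rfl := hj
        · simpa using hmem 0 (by omega)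
        · simpa using hmem 1 (by omega)
        · simpa using hmem 2 (by omega)
        · simpa using hmem 3 (by omega)
      have h4 := Set.ncard_le_ncard hsub (Set.toFinite _)
      rw [Set.ncard_coe_finset] at h4
      have : ∀ i : ZMod 6, #({i, i + 1, i + 2, i + 3} : Finset (ZMod 6)) = 4 := by decide
      rw [this] at h4
      omega

namespace Config

theorem outgoing_adj {C : Config} {p q : Node} (h : C.Outgoing p q) : triGrid.Adj p q :=
  (C.mem_of_out p q h.1).2.2

theorem arc_iff_R2_R3 (L : PortLabelling) (C : Config) (p : Node) :
    Arc (fun i => C.Outgoing p (p + dir i)) ↔ C.R2 p ∧ C.R3 L p := by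
  obtain ⟨f, c, hf, hc⟩ := L.exists_affine p
  rw [← Arc.comp_affine hc (m := fun i => C.Outgoing p (p + dir i)), arc_iff_interval]
  have hset : {q | C.Outgoing p q} =
      (fun j => (L.port p j : Node)) '' {j | C.Outgoing p (p + dir (f j))} := by
    ext q
    simp only [Set.mem_ofPred_eq, Set.mem_image]
    constructor
    · intro h
      refine ⟨(L.port p).symm ⟨q, outgoing_adj h⟩, ?_, by simp⟩
      rw [← hf]
      simpa using h
    · rintro ⟨j, hj, rfl⟩
      rwa [hf]
  unfold R2 R3
  rw [hset, Set.ncard_image_of_injective _ (f := fun j => (L.port p j : Node))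
    (Subtype.val_injective.comp (L.port p).injective)]
  simp only [hf]

/-! ### The execution of the algorithm by one particle -/

theorem link_eq_inn {C : Config} {p q : Node} : C.link p q = Link.inn ↔ ¬ C.link p q = Link.out := by
  cases C.link p q <;> simp

/-- The edge `pq` is not claimed by `q`, so that `p` may claim it. -/
def Candidate (C : Config) (p q : Node) : Prop :=
  p ∈ C.support ∧ q ∈ C.support ∧ triGrid.Adj p q ∧ ¬ C.link q p = Link.out

/-- R2, R3 and R4 hold at `p` once `p` claims all its candidates. -/
def Accepts (C : Config) (p : Node) : Prop :=
  Arc (fun i => C.Candidate p (p + dir i)) ∧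
    ∀ q r, ¬ (C.Candidate p q ∧ C.Outgoing q r ∧ C.link r p = Link.out)

theorem write_link_self {C : Config} {p v : Node} {r : Node → Link} :
    (C.write p r).link p v = Link.out ↔
      (p ∈ C.support ∧ v ∈ C.support ∧ triGrid.Adj p v) ∧ r v = Link.out := by
  simp only [write, if_true]
  split_ifs with h <;> simp [h]

theorem write_link_of_ne {C : Config} {p u v : Node} {r : Node → Link} (h : u ≠ p) :
    (C.write p r).link u v = C.link u v := by
  simp [write, h]

theorem resolve_link_self {C : Config} {p v : Node} :
    (C.resolve p).link p v = Link.out ↔ C.Outgoing p v := by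
  unfold resolve
  rw [write_link_self]
  simp only [Conflicting, Outgoing, link_eq_inn]
  have := C.mem_of_out p v
  by_cases h : C.link p v = Link.out ∧ C.link v p = Link.out
  · simp [h]
  · simp only [h, if_false]
    tauto

theorem resolve_link_of_ne {C : Config} {p u v : Node} (h : u ≠ p) :
    (C.resolve p).link u v = C.link u v := write_link_of_ne h

theorem line1_link_of_ne {C : Config} {p u v : Node} (h : u ≠ p) :
    (C.line1 p).link u v = C.link u v := by
  unfold line1
  split_ifs
  · rfl
  · exact write_link_of_ne h

theorem line1_resolve_link_self {C : Config} {p v : Node} (hp : p ∈ C.support) :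
    ((C.resolve p).line1 p).link p v = Link.out ↔ C.Candidate p v := by
  have hsupp : (C.resolve p).support = C.support := rfl
  have hne : ∀ q, triGrid.Adj p q → (C.resolve p).link q p = C.link q p := fun q h =>
    resolve_link_of_ne h.ne'
  unfold line1
  split_ifs with h
  swap
  · rw [write_link_self, hsupp]
    by_cases hu : (C.resolve p).Undirected p v
    · rw [if_pos hu]
      obtain ⟨-, hv, ha, -, hl⟩ := hu
      rw [hne v ha] at hl
      exact iff_of_true ⟨⟨hp, hv, ha⟩, rfl⟩ ⟨hp, hv, ha, link_eq_inn.1 hl⟩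
    · rw [if_neg hu, resolve_link_self]
      constructor
      · rintro ⟨⟨-, hv, ha⟩, hl⟩
        exact ⟨hp, hv, ha, link_eq_inn.1 hl.2⟩
      · rintro ⟨-, hv, ha, hl⟩
        refine ⟨⟨hp, hv, ha⟩, resolve_link_self.1 ?_⟩
        by_contra hc
        exact hu ⟨hp, hv, ha, link_eq_inn.2 hc, by rw [hne v ha, link_eq_inn]; exact hl⟩
  · rw [resolve_link_self]
    constructor
    · rintro ⟨h₁, h₂⟩
      obtain ⟨-, hv, ha⟩ := C.mem_of_out _ _ h₁
      exact ⟨hp, hv, ha, link_eq_inn.1 h₂⟩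
    · rintro ⟨-, hv, ha, hl⟩
      obtain h' | h' := h v hv ha
      · exact resolve_link_self.1 h'.1
      · exact absurd (hne v ha ▸ h'.1) hl

theorem exec_link_of_ne {L : PortLabelling} {C : Config} {p u v : Node} (h : u ≠ p) :
    (C.exec L p).link u v = C.link u v := by
  have : (C.exec L p).link u v = ((C.resolve p).line1 p).link u v := by
    unfold exec line2
    split_ifs
    · exact write_link_of_ne h
    · rfl
  rw [this, line1_link_of_ne h, resolve_link_of_ne h]

theorem line1_support (C : Config) (p : Node) : (C.line1 p).support = C.support := by
  unfold line1
  split_ifs <;> rfl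

/-- Normal form of the algorithm: p claims either every edge not claimed by the other end or none at
all. The rest of the proof uses only this description. -/
theorem exec_link_self {L : PortLabelling} {C : Config} {p v : Node} (hp : p ∈ C.support) :
    (C.exec L p).link p v = Link.out ↔ C.Candidate p v ∧ C.Accepts p := by
  unfold exec
  have hself := fun v => line1_resolve_link_self (C := C) (v := v) hp
  have hne : ∀ u v, u ≠ p → ((C.resolve p).line1 p).link u v = C.link u v := fun u v h => by
    rw [line1_link_of_ne h, resolve_link_of_ne h]
  have hsupp : ((C.resolve p).line1 p).support = C.support := line1_support _ _
  set D := (C.resolve p).line1 p with hD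
  have hout : ∀ q, D.Outgoing p q ↔ C.Candidate p q := by
    intro q
    simp only [Outgoing, hself, link_eq_inn]
    refine ⟨And.left, fun h => ⟨h, ?_⟩⟩
    rw [hne _ _ h.2.2.1.ne']
    exact h.2.2.2
  have hR4 : D.R4 p ↔ ∀ q r, ¬ (C.Candidate p q ∧ C.Outgoing q r ∧ C.link r p = Link.out) := by
    unfold R4
    refine forall_congr' fun q => forall_congr' fun r => not_congr ?_
    rw [hout]
    refine and_congr_right fun hq => ?_
    have hqp : q ≠ p := hq.2.2.1.ne'
    by_cases hr : r = p
    · subst hr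
      constructor
      · rintro ⟨h, -⟩
        exact absurd (hne _ _ hqp ▸ h.1) hq.2.2.2
      · rintro ⟨h, -⟩
        exact absurd h.1 hq.2.2.2
    · simp only [Outgoing, hne _ _ hqp, hne _ _ hr]
      refine and_congr_right fun _ => ⟨And.left, fun h => ⟨h, ?_⟩⟩
      rw [link_eq_inn, hself]
      exact fun h' => h'.2.2.2 h
  have hacc : C.Accepts p ↔ D.R2 p ∧ D.R3 L p ∧ D.R4 p := by
    rw [← and_assoc, ← arc_iff_R2_R3, hR4]
    simp only [hout]
    rfl
  unfold line2
  split_ifs with h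
  · have hno : ¬ C.Accepts p := by
      rw [hacc]
      tauto
    simp only [hno, and_false, iff_false]
    rw [write_link_self]
    rintro ⟨-, h'⟩
    split_ifs at h' with ho
    exact ho ((hout v).2 ((hself v).1 h'))
  · have hyes : C.Accepts p := by
      rw [hacc]
      tauto
    simp [hself, hyes]

theorem fire_singleton (L : PortLabelling) (C : Config) (p : Node) :
    C.fire L {p} = C.exec L p := by
  apply Config.ext
  · exact (exec_support L C p).symm
  · funext u v
    by_cases h : u = p
    · subst h
      simp [fire]
    · simp [fire, h, exec_link_of_ne h]

theorem exec_eq_self {L : PortLabelling} {C : Config} {p : Node}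
    (h : (C.exec L p).link p = C.link p) : C.exec L p = C := by
  apply Config.ext
  · exact exec_support L C p
  · funext u v
    by_cases hu : u = p
    · rw [hu, h]
    · exact exec_link_of_ne hu

/-! ### Configurations without conflicts -/

/-- `p` marks its edge to `q` as outgoing. -/
abbrev Claims (C : Config) (p q : Node) : Prop := C.link p q = Link.out

theorem Claims.adj {C : Config} {p q : Node} (h : C.Claims p q) : triGrid.Adj p q :=
  (C.mem_of_out p q h).2.2

theorem Undirected.symm {C : Config} {p q : Node} (h : C.Undirected p q) : C.Undirected q p :=
  ⟨h.2.1, h.1, h.2.2.1.symm, h.2.2.2.2, h.2.2.2.1⟩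

/-- `p` has no conflicting edge, and it satisfies R2, R3 and R4. -/
def CleanAt (C : Config) (p : Node) : Prop :=
  (∀ q, C.Claims p q → ¬ C.Claims q p) ∧ Arc (fun i => C.Claims p (p + dir i)) ∧ C.R4 p

theorem R4.rotate {C : Config} {p q r : Node} (h : C.R4 q) :
    ¬ (C.Outgoing p q ∧ C.Outgoing q r ∧ C.Outgoing r p) :=
  fun ⟨h₁, h₂, h₃⟩ => h r p ⟨h₂, h₃, h₁⟩

variable {L : PortLabelling} {C : Config} {p q : Node}

theorem exec_claims_of_ne {u v : Node} (h : u ≠ p) :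
    (C.exec L p).Claims u v ↔ C.Claims u v := by
  rw [Claims, exec_link_of_ne h]

theorem exec_claims_symm_false (hp : p ∈ C.support) (h : (C.exec L p).Claims p q) :
    ¬ C.Claims q p := by
  rw [Claims, exec_link_self hp] at h
  exact h.1.2.2.2

theorem exec_outgoing_of_ne {u v : Node} (hu : u ≠ p) (hv : v ≠ p) :
    (C.exec L p).Outgoing u v ↔ C.Outgoing u v := by
  simp only [Outgoing, exec_link_of_ne hu, exec_link_of_ne hv]

theorem cleanAt_exec_self (hp : p ∈ C.support) : (C.exec L p).CleanAt p := by
  have hself := fun v => exec_link_self (L := L) (C := C) (v := v) hp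
  refine ⟨fun q h => ?_, ?_, ?_⟩
  · rw [exec_claims_of_ne h.adj.ne']
    exact exec_claims_symm_false hp h
  · simp only [Claims, hself]
    by_cases h : C.Accepts p
    · simpa only [h, and_true] using h.1
    · exact Or.inl fun i hi => h hi.2
  · rintro q r ⟨h₁, h₂, h₃⟩
    have hc := (hself q).1 h₁.1
    have hq : q ≠ p := (outgoing_adj h₁).ne'
    have hr : r ≠ p := (outgoing_adj h₃).ne
    refine hc.2.2 q r ⟨hc.1, (exec_outgoing_of_ne hq hr).1 h₂, ?_⟩
    rw [← exec_link_of_ne (L := L) hr]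
    exact h₃.1

/-- The executing q never claims an edge claimed by p, and a directed triangle through q is excluded
by R4 at q itself. -/
theorem CleanAt.exec (h : C.CleanAt p) (hq : q ∈ C.support) : (C.exec L q).CleanAt p := by
  by_cases hpq : p = q
  · subst hpq
    exact cleanAt_exec_self hq
  · obtain ⟨h₁, h₂, h₃⟩ := h
    refine ⟨fun v hv => ?_, ?_, ?_⟩
    · rw [exec_claims_of_ne hpq] at hv
      by_cases hvq : v = q
      · subst hvq
        exact fun h' => exec_claims_symm_false hq h' hv
      · rw [exec_claims_of_ne hvq]
        exact h₁ v hv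
    · simpa only [exec_claims_of_ne hpq] using h₂
    · have hR4 := (cleanAt_exec_self (L := L) hq).2.2
      intro a b hab
      by_cases ha : a = q
      · subst ha
        exact hR4.rotate hab
      · by_cases hb : b = q
        · subst hb
          exact hR4.rotate ⟨hab.2.1, hab.2.2, hab.1⟩
        · simp only [exec_outgoing_of_ne, hpq, ha, hb, ne_eq, not_false_eq_true] at hab
          exact h₃ a b hab

/-- No edge is conflicting, and R2, R3 and R4 hold everywhere. -/
def Clean (C : Config) : Prop := ∀ p ∈ C.support, C.CleanAt p

theorem Clean.exec (h : C.Clean) (hq : q ∈ C.support) : (C.exec L q).Clean := fun p hp =>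
  (h p (by rwa [exec_support] at hp)).exec hq

theorem Clean.asymm (h : C.Clean) (hpq : C.Claims p q) : ¬ C.Claims q p :=
  (h p (C.mem_of_out p q hpq).1).1 q hpq

theorem Clean.outgoing_iff (h : C.Clean) : C.Outgoing p q ↔ C.Claims p q :=
  ⟨And.left, fun h' => ⟨h', link_eq_inn.2 (h.asymm h')⟩⟩

theorem Clean.no_triangle (h : C.Clean) {r : Node} :
    ¬ (C.Claims p q ∧ C.Claims q r ∧ C.Claims r p) := by
  intro h'
  simp only [← h.outgoing_iff] at h'
  exact (h p (C.mem_of_out p q h'.1.1).1).2.2 q r h'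

theorem Clean.candidate (h : C.Clean) (hpq : C.Claims p q) : C.Candidate p q :=
  have h' := C.mem_of_out p q hpq
  ⟨h'.1, h'.2.1, h'.2.2, h.asymm hpq⟩

theorem Candidate.claims_or (h : C.Candidate p q) : C.Claims p q ∨ C.Undirected p q := by
  by_cases h' : C.Claims p q
  · exact Or.inl h'
  · exact Or.inr ⟨h.1, h.2.1, h.2.2.1, link_eq_inn.2 h', link_eq_inn.2 h.2.2.2⟩

theorem Clean.exec_eq_self (h : C.Clean) (hp : p ∈ C.support) (hu : ∀ q, ¬ C.Undirected p q) :
    C.exec L p = C := by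
  have hcand : ∀ q, C.Candidate p q ↔ C.Claims p q := fun q =>
    ⟨fun h' => h'.claims_or.resolve_right (hu q), h.candidate⟩
  have hacc : C.Accepts p := by
    refine ⟨?_, fun q r h' => ?_⟩
    · simpa only [hcand] using (h p hp).2.1
    · rw [hcand, h.outgoing_iff] at h'
      exact h.no_triangle h'
  apply Config.exec_eq_self
  funext v
  have : (C.exec L p).link p v = Link.out ↔ C.link p v = Link.out := by
    rw [exec_link_self hp, hcand]
    simp [hacc]
  cases h₁ : (C.exec L p).link p v <;> cases h₂ : C.link p v <;> simp_all

/-! ### Reachability -/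

/-- `D` is obtained from `C` by a sequence of executions of single particles. -/
abbrev Reach (L : PortLabelling) (C D : Config) : Prop :=
  Relation.ReflTransGen (SeqSuccessor L) C D

theorem reach_exec (hp : p ∈ C.support) : Reach L C (C.exec L p) := by
  by_cases h : (C.exec L p).link p = C.link p
  · rw [Config.exec_eq_self h]
  · exact Relation.ReflTransGen.single ⟨p, ⟨hp, h⟩, (fire_singleton L C p).symm⟩

/-- A property that is preserved by the executions of single particles is preserved. -/
theorem Reach.induction {I : Config → Prop} {D : Config} (h : Reach L C D) (h₀ : I C)
    (step : ∀ E, Reach L C E → I E → ∀ p ∈ E.support, I (E.exec L p)) : I D := by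
  induction h with
  | refl => exact h₀
  | tail hE hs ih =>
    obtain ⟨p, hp, rfl⟩ := hs
    rw [fire_singleton]
    exact step _ hE ih p hp.1

theorem Reach.support {D : Config} (h : Reach L C D) : D.support = C.support :=
  h.induction (I := fun D => D.support = C.support) rfl fun E _ hE p _ => by
    rw [exec_support, hE]

theorem Clean.reach (hC : C.Clean) {D : Config} (h : Reach L C D) : D.Clean :=
  h.induction (I := Clean) hC fun _ _ hE _ hp => hE.exec hp

theorem exists_reach_clean (L : PortLabelling) (C : Config) : ∃ D, Reach L C D ∧ D.Clean := by
  have : ∀ F ⊆ C.support, ∃ D, Reach L C D ∧ ∀ p ∈ F, D.CleanAt p := by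
    intro F
    induction F using Finset.induction_on with
    | empty => exact fun _ => ⟨C, Relation.ReflTransGen.refl, by simp⟩
    | insert p F _ ih =>
      intro hF
      obtain ⟨D, hD, h⟩ := ih ((subset_insert _ _).trans hF)
      have hp : p ∈ D.support := hD.support ▸ hF (mem_insert_self _ _)
      refine ⟨D.exec L p, hD.trans (reach_exec hp), fun q hq => ?_⟩
      obtain rfl | hq := mem_insert.1 hq
      · exact cleanAt_exec_self hp
      · exact (h q hq).exec hp
  obtain ⟨D, hD, h⟩ := this _ Subset.rfl
  exact ⟨D, hD, fun p hp => h p (hD.support ▸ hp)⟩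

theorem exists_reach_maximal (f : Config → ℕ) {B : ℕ} (hf : ∀ D, f D ≤ B) (L : PortLabelling)
    (C : Config) : ∃ D, Reach L C D ∧ ∀ E, Reach L D E → f E ≤ f D := by
  classical
  have hex : ∃ n, ∃ D, Reach L C D ∧ B - f D = n := ⟨_, C, Relation.ReflTransGen.refl, rfl⟩
  obtain ⟨D, hD, hn⟩ := Nat.find_spec hex
  refine ⟨D, hD, fun E hE => ?_⟩
  have := Nat.find_min' hex ⟨E, hD.trans hE, rfl⟩
  have h₁ := hf D
  have h₂ := hf E
  omega

/-! ### Sets of particles that cannot affect the others -/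

/-- `Z` contains the particles with an undirected edge, and no edge leaves `Z`. -/
structure Closed (C : Config) (Z : Finset Node) : Prop where
  subset : Z ⊆ C.support
  undirected : ∀ p q, C.Undirected p q → p ∈ Z
  claims : ∀ p ∈ Z, ∀ q, C.Claims p q → q ∈ Z

theorem closed_support (C : Config) : C.Closed C.support where
  subset := Subset.rfl
  undirected _ _ h := h.1
  claims _ _ _ h := (C.mem_of_out _ _ h).2.1

variable {X : Finset Node}

theorem Closed.claims_of_notMem (h : C.Closed X) (hp : p ∈ C.support) (hpX : p ∉ X) (hq : q ∈ X)
    (hpq : triGrid.Adj p q) : C.Claims p q := by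
  by_contra hc
  refine hpX (h.undirected p q ⟨hp, h.subset hq, hpq, link_eq_inn.2 hc, link_eq_inn.2 fun h' => ?_⟩)
  exact hpX (h.claims q hq p h')

theorem Closed.mem_of_candidate (h : C.Closed X) (hp : p ∈ X) (hpq : C.Candidate p q) : q ∈ X := by
  by_contra hq
  exact hpq.2.2.2 (h.claims_of_notMem hpq.2.1 hq hp hpq.2.2.1.symm)

/-- Particles outside X are idle, and those inside cannot claim an edge to the outside because the
outer end already claims it. -/
theorem Closed.exec (hX : C.Closed X) (hC : C.Clean) (hp : p ∈ C.support) :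
    (C.exec L p).Closed X := by
  by_cases hpX : p ∈ X
  · refine ⟨by rw [exec_support]; exact hX.subset, ?_, ?_⟩
    · have key : ∀ v, (C.exec L p).Undirected p v → v ∈ X := by
        rintro v ⟨hp, hv, ha, -, h⟩
        rw [exec_support] at hp hv
        rw [exec_link_of_ne ha.ne'] at h
        exact hX.mem_of_candidate hpX ⟨hp, hv, ha, link_eq_inn.1 h⟩
      intro u v h
      by_cases hu : u = p
      · exact hu ▸ hpX
      · by_cases hv : v = p
        · exact key u (hv ▸ h.symm)
        · obtain ⟨h₁, h₂, h₃, h₄, h₅⟩ := h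
          rw [exec_support] at h₁ h₂
          rw [exec_link_of_ne hu] at h₄
          rw [exec_link_of_ne hv] at h₅
          exact hX.undirected u v ⟨h₁, h₂, h₃, h₄, h₅⟩
    · intro u hu v h
      by_cases hup : u = p
      · subst hup
        exact hX.mem_of_candidate hu ((exec_link_self hp).1 h).1
      · exact hX.claims u hu v ((exec_claims_of_ne hup).1 h)
  · rwa [hC.exec_eq_self hp fun q hq => hpX (hX.undirected p q hq)]

theorem Closed.reach (hX : C.Closed X) (hC : C.Clean) {D : Config} (h : Reach L C D) :
    D.Closed X :=
  h.induction (I := fun D => D.Closed X) hX fun _ hr hE _ hp => hE.exec (hC.reach hr) hp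

/-- A hole of X filled with particles would be a fully directed region with all boundary edges
outgoing, against `no_outward_region`. -/
theorem Closed.noHole (hX : C.Closed X) (hC : C.Clean) (hP : NoHole C.support) : NoHole X := by
  intro Y hY
  by_cases hYP : Y ⊆ C.support
  · by_contra! hcon
    have hW : ∀ w ∈ Y \ X, w ∈ C.support ∧ w ∉ X := fun w hw =>
      ⟨hYP (mem_sdiff.1 hw).1, (mem_sdiff.1 hw).2⟩
    refine no_outward_region (O := C.Claims) (W := Y \ X) (sdiff_nonempty.2 hY.2)
      (fun w hw => (hC w (hW w hw).1).2.1) (fun w hw i => ?_) fun w hw w' hw' ha => ?_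
    · by_cases h : w + dir i ∈ X
      · exact Or.inr (hX.claims_of_notMem (hW w hw).1 (hW w hw).2 h (adj_dir _ _))
      · refine Or.inl (mem_sdiff.2 ⟨?_, h⟩)
        by_contra h'
        exact hcon w (mem_sdiff.1 hw).1 (hW w hw).2 _ h' (adj_dir _ _)
    · by_contra! hc
      exact (hW w hw).2 (hX.undirected w w'
        ⟨(hW w hw).1, (hW w' hw').1, ha, link_eq_inn.2 hc.1, link_eq_inn.2 hc.2⟩)
  · obtain ⟨y, hy, hyP⟩ := not_subset.1 hYP
    obtain ⟨q, hq, hqP, z, hz, hqz⟩ := hP (C.support ∪ Y)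
      ⟨subset_union_left, fun h => hyP (h (mem_union_right _ hy))⟩
    exact ⟨q, (mem_union.1 hq).resolve_left hqP, fun h => hqP (hX.subset h), z,
      fun h => hz (mem_union_right _ h), hqz⟩

/-- Particles that can never again be without claims have permanently directed edges once no further
claim can become permanent. Removing all of them from X leaves a closed set, so by minimality there
are none. -/
theorem exists_reach_no_claims (hC : C.Clean) (hX : C.Closed X)
    (hmin : ∀ D, Reach L C D → ∀ Z ⊆ X, D.Closed Z → Z = X) (hq : q ∈ X) :
    ∃ D, Reach L C D ∧ ∀ v, ¬ D.Claims q v := by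
  classical
  -- The permanent claims. They only grow along executions, so at a configuration with the most of
  -- them they stay constant.
  let F : Config → Finset (Node × Node) := fun D =>
    (C.support ×ˢ C.support).filter fun e => ∀ E, Reach L D E → E.Claims e.1 e.2
  obtain ⟨D, hCD, hD⟩ := exists_reach_maximal (fun D => #(F D))
    (fun D => card_le_card (filter_subset _ _)) L C
  have hF : ∀ E, Reach L D E → F E = F D := by
    intro E hE
    refine (eq_of_subset_of_card_le ?_ (hD E hE)).symm
    exact fun e he => mem_filter.2 ⟨(mem_filter.1 he).1, fun E' hE' =>
      (mem_filter.1 he).2 E' (hE.trans hE')⟩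
  let N := X.filter fun p => ∀ E, Reach L D E → ∃ v, E.Claims p v
  have hfrozen : ∀ p ∈ N, ∀ v E, Reach L D E → E.Claims p v →
      ∀ E', Reach L D E' → E'.Claims p v := by
    intro p hp v E hE hpv E' hE'
    have hmem : (p, v) ∈ F E := by
      have hm := E.mem_of_out p v hpv
      rw [Reach.support (hCD.trans hE)] at hm
      refine mem_filter.2 ⟨mem_product.2 ⟨hm.1, hm.2.1⟩, fun G hG => ?_⟩
      refine hG.induction (I := fun G => G.Claims p v) hpv fun G hG hpv' r hr => ?_
      by_cases h : p = r
      · subst h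
        obtain ⟨w, hw⟩ := (mem_filter.1 hp).2 _ ((hE.trans hG).trans (reach_exec hr))
        rw [Claims, exec_link_self hr] at hw ⊢
        exact ⟨(hC.reach ((hCD.trans hE).trans hG)).candidate hpv', hw.2⟩
      · rwa [exec_claims_of_ne h]
    rw [hF E hE, ← hF E' hE'] at hmem
    exact (mem_filter.1 hmem).2 E' Relation.ReflTransGen.refl
  have hundir : ∀ p ∈ N, ∀ E, Reach L D E → ∀ v, ¬ E.Undirected p v := by
    intro p hp E hE v hu
    -- If p executed, it would still claim something, hence would claim all candidates, including v;
    -- that claim would be permanent, and so already present.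
    obtain ⟨w, hw⟩ := (mem_filter.1 hp).2 _ (hE.trans (reach_exec hu.1))
    have hcl : (E.exec L p).Claims p v := by
      rw [Claims, exec_link_self hu.1] at hw ⊢
      exact ⟨⟨hu.1, hu.2.1, hu.2.2.1, link_eq_inn.1 hu.2.2.2.2⟩, hw.2⟩
    exact link_eq_inn.1 hu.2.2.2.1 (hfrozen p hp v _ (hE.trans (reach_exec hu.1)) hcl E hE)
  have hDX := hX.reach hC hCD
  have hclosed : D.Closed (X \ N) := by
    refine ⟨sdiff_subset.trans hDX.subset, fun p v h => ?_, fun z hz p hzp => ?_⟩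
    · exact mem_sdiff.2 ⟨hDX.undirected p v h, fun hp =>
        hundir p hp D Relation.ReflTransGen.refl v h⟩
    · obtain ⟨hzX, hzN⟩ := mem_sdiff.1 hz
      refine mem_sdiff.2 ⟨hDX.claims z hzX p hzp, fun hp => ?_⟩
      have : ∃ E, Reach L D E ∧ ∀ v, ¬ E.Claims z v := by
        by_contra! hcon
        exact hzN (mem_filter.2 ⟨hzX, hcon⟩)
      obtain ⟨E, hE, hno⟩ := this
      have hm := D.mem_of_out z p hzp
      rw [← hE.support] at hm
      have hpz : E.Claims p z := by
        by_contra hc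
        exact hundir p hp E hE z
          ⟨hm.2.1, hm.1, hm.2.2.symm, link_eq_inn.2 hc, link_eq_inn.2 (hno p)⟩
      exact (hC.reach hCD).asymm hzp (hfrozen p hp z E hE hpz D Relation.ReflTransGen.refl)
  have hqN : q ∉ N := by
    rw [← hmin D hCD _ sdiff_subset hclosed] at hq
    exact (mem_sdiff.1 hq).2
  by_contra! hcon
  exact hqN (mem_filter.2 ⟨hq, fun E hE => hcon E (hCD.trans hE)⟩)

theorem Closed.erase {u : Node} (hX : C.Closed X) (hu : ∀ v, ¬ C.Undirected u v)
    (hin : ∀ r ∈ X, ¬ C.Claims r u) : C.Closed (X.erase u) where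
  subset := (erase_subset _ _).trans hX.subset
  undirected p q h := mem_erase.2 ⟨fun e => hu q (e ▸ h), hX.undirected p q h⟩
  claims p hp q h := mem_erase.2 ⟨fun e => hin p (mem_of_mem_erase hp) (e ▸ h),
    hX.claims p (mem_of_mem_erase hp) q h⟩

theorem Closed.accepts {u : Node} {k : ZMod 6} (hX : C.Closed X) (hu : u ∈ X)
    (hk : ∀ j, u + dir j ∈ X → j = k - 1 ∨ j = k ∨ j = k + 1) (hb : C.Candidate u (u + dir k))
    (htri : ∀ q r, ¬ (C.Candidate u q ∧ C.Outgoing q r ∧ C.Claims r u)) : C.Accepts u :=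
  ⟨Or.inr ⟨k, hb, fun j hj => hk j (hX.mem_of_candidate hu hj)⟩, htri⟩

theorem undirected_exec_of_ne {u v : Node} (hu : u ≠ p) (hv : v ≠ p) :
    (C.exec L p).Undirected u v ↔ C.Undirected u v := by
  simp only [Undirected, exec_support, exec_link_of_ne hu, exec_link_of_ne hv]

theorem Accepts.exec_not_undirected {u v : Node} (h : C.Accepts u) :
    ¬ (C.exec L u).Undirected u v := by
  rintro ⟨h₁, h₂, h₃, h₄, h₅⟩
  rw [exec_support] at h₁ h₂
  rw [exec_link_of_ne h₃.ne'] at h₅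
  exact link_eq_inn.1 h₄ ((exec_link_self h₁).2 ⟨⟨h₁, h₂, h₃, link_eq_inn.1 h₅⟩, h⟩)

/-- Induction on the number n of edges entering u from X. With none, X without u is closed.
Otherwise some r claiming u can be brought to drop its claims; at the first drop of an edge into u
on the way, u claims that edge and n decreases. -/
theorem no_center (hC : C.Clean) (hX : C.Closed X)
    (hmin : ∀ D, Reach L C D → ∀ Z ⊆ X, D.Closed Z → Z = X) {u : Node} {k : ZMod 6} (hu : u ∈ X)
    (hk : ∀ j, u + dir j ∈ X → j = k - 1 ∨ j = k ∨ j = k + 1) (n : ℕ) :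
    ∀ E, Reach L C E → E.Claims u (u + dir k) → (∀ v, ¬ E.Undirected u v) →
      {r | r ∈ X ∧ E.Claims r u}.ncard ≠ n := by
  induction n using Nat.strong_induction_on with
  | _ n ih =>
    intro E hE hb hund hn
    have hEX := hX.reach hC hE
    have hfin : ∀ E' : Config, {r | r ∈ X ∧ E'.Claims r u}.Finite := fun E' =>
      X.finite_toSet.subset fun r hr => hr.1
    by_cases hin : ∀ r ∈ X, ¬ E.Claims r u
    · have := hmin E hE _ (erase_subset u X) (hEX.erase hund hin)
      exact notMem_erase u X (this.symm ▸ hu : u ∈ X.erase u)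
    push Not at hin
    obtain ⟨r, hrX, hr⟩ := hin
    obtain ⟨G, hG, hGr⟩ := exists_reach_no_claims (L := L) (hC.reach hE) hEX
      (fun D hD => hmin D (hE.trans hD)) hrX
    have key : G.Claims u (u + dir k) ∧ (∀ v, ¬ G.Undirected u v) ∧
        ∀ r ∈ X, G.Claims r u ↔ E.Claims r u := by
      refine hG.induction (I := fun G => G.Claims u (u + dir k) ∧ (∀ v, ¬ G.Undirected u v) ∧
        ∀ r ∈ X, G.Claims r u ↔ E.Claims r u) ⟨hb, hund, fun r _ => Iff.rfl⟩ ?_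
      rintro G hG ⟨hGb, hGu, hGin⟩ p hp
      have hGC := hC.reach (hE.trans hG)
      have hGX := hX.reach hC (hE.trans hG)
      by_cases hself : ∀ q, ¬ G.Undirected p q
      · rw [hGC.exec_eq_self hp hself]
        exact ⟨hGb, hGu, hGin⟩
      push Not at hself
      obtain ⟨q, hpq⟩ := hself
      have hpX := hGX.undirected p q hpq
      have hpu : u ≠ p := fun e => hGu q (e ▸ hpq)
      have hGb' : (G.exec L p).Claims u (u + dir k) := (exec_claims_of_ne hpu).2 hGb
      by_cases hclaim : (G.exec L p).Claims p u ↔ G.Claims p u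
      · refine ⟨hGb', fun v hv => ?_, fun r hr => ?_⟩
        · by_cases hvp : v = p
          · subst hvp
            obtain ⟨h₁, h₂, h₃, h₄, h₅⟩ := hv
            rw [exec_support] at h₁ h₂
            rw [exec_link_of_ne hpu] at h₄
            refine hGu v ⟨h₁, h₂, h₃, h₄, ?_⟩
            rw [link_eq_inn] at h₅ ⊢
            exact fun h => h₅ (hclaim.2 h)
          · exact hGu v ((undirected_exec_of_ne hpu hvp).1 hv)
        · by_cases hrp : r = p
          · subst hrp
            rw [hclaim]
            exact hGin r hr
          · rw [exec_claims_of_ne hrp]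
            exact hGin r hr
      · exfalso
        -- A change can only be a loss: u has no undirected edge, so p has no new edge to claim
        -- there. Then p did not accept and has reset all its claims.
        have hGpu : G.Claims p u := by
          by_contra hc
          refine hclaim (iff_of_false (fun h => ?_) hc)
          obtain h' | h' := ((exec_link_self hp).1 h).1.claims_or
          · exact hc h'
          · exact hGu p h'.symm
        have hnacc : ¬ G.Accepts p := fun h =>
          hclaim (iff_of_true ((exec_link_self hp).2 ⟨hGC.candidate hGpu, h⟩) hGpu)
        have hreset : ∀ v, ¬ (G.exec L p).Claims p v := fun v h =>
          hnacc ((exec_link_self hp).1 h).2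
        have hHC := hGC.exec (L := L) hp
        have hHX := hGX.exec (L := L) hGC hp
        have hreach := (hE.trans hG).trans (reach_exec (L := L) hp)
        set H := G.exec L p with hH
        -- The only undirected edge of u is the one to p, and p has no outgoing edge, so claiming it
        -- closes no directed triangle.
        have hacc : H.Accepts u := by
          refine hHX.accepts hu hk (hHC.candidate hGb') fun q r h => ?_
          obtain ⟨h₁, h₂, h₃⟩ := h
          have hqp : q ≠ p := fun e => hreset r (e ▸ h₂.1)
          obtain h' | h' := h₁.claims_or
          · exact hHC.no_triangle ⟨h', h₂.1, h₃⟩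
          · exact hGu q ((undirected_exec_of_ne hpu hqp).1 h')
        have huH : u ∈ H.support := hHX.subset hu
        refine ih _ ?_ (H.exec L u) (hreach.trans (reach_exec huH))
          ((exec_link_self huH).2 ⟨hHC.candidate hGb', hacc⟩)
          (fun v => hacc.exec_not_undirected) rfl
        rw [← hn]
        refine Set.ncard_lt_ncard ⟨?_, ?_⟩ (hfin E)
        · rintro r ⟨hr, h⟩
          rw [exec_claims_of_ne h.adj.ne] at h
          have hrp : r ≠ p := fun e => hreset u (e ▸ h)
          exact ⟨hr, (hGin r hr).1 ((exec_claims_of_ne hrp).1 h)⟩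
        · intro hsub
          have h := (hsub ⟨hpX, (hGin p hpX).1 hGpu⟩).2
          rw [exec_claims_of_ne h.adj.ne] at h
          exact hreset u h
    exact hGr u ((key.2.2 r hrX).2 hr)

theorem exists_reach_smaller (hC : C.Clean) (hX : C.Closed X) (hP : NoHole C.support)
    (hne : X.Nonempty) (L : PortLabelling) : ∃ D Z, Reach L C D ∧ Z ⊂ X ∧ D.Closed Z := by
  by_contra! hcon
  have hmin : ∀ D, Reach L C D → ∀ Z ⊆ X, D.Closed Z → Z = X := fun D hD Z hZ hc =>
    hZ.eq_or_ssubset.resolve_right fun h => hcon D Z hD h hc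
  obtain ⟨u, hu, harc⟩ := (hX.noHole hC hP).exists_arc hne
  obtain hno | ⟨k, hkX, hk⟩ := harc
  · have hno' : ∀ r ∈ X, ¬ triGrid.Adj u r := by
      intro r hr h
      obtain ⟨i, rfl⟩ := adj_iff.1 h
      exact hno i hr
    have := hmin C Relation.ReflTransGen.refl _ (erase_subset u X) (hX.erase
      (fun v h => hno' v (hX.undirected v u h.symm) h.2.2.1) fun r hr h => hno' r hr h.adj.symm)
    exact notMem_erase u X (this.symm ▸ hu : u ∈ X.erase u)
  · obtain ⟨D, hD, hDb⟩ := exists_reach_no_claims hC hX hmin hkX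
    have hDX := hX.reach hC hD
    have huD := hDX.subset hu
    have hb : D.Candidate u (u + dir k) := ⟨huD, hDX.subset hkX, adj_dir _ _, hDb u⟩
    -- In a directed triangle u, q, r, the nodes q and r would be adjacent members of the arc, so
    -- one of them would be its middle, which has no outgoing edge.
    have hacc : D.Accepts u := by
      refine hDX.accepts hu hk hb fun q r h => ?_
      obtain ⟨h₁, h₂, h₃⟩ := h
      have hqX := hDX.mem_of_candidate hu h₁
      have hrX := hDX.claims q hqX r h₂.1
      obtain ⟨i, rfl⟩ := adj_iff.1 h₁.2.2.1
      obtain ⟨j, rfl⟩ := adj_iff.1 h₃.adj.symm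
      have hi := hk i hqX
      have hj := hk j hrX
      have hij := adj_dir_dir.1 (outgoing_adj h₂)
      have hik : i ≠ k := fun e => hDb _ (e ▸ h₂.1)
      have hjk : j ≠ k := fun e => hDb _ (e ▸ h₃)
      clear h₁ h₂ h₃ hqX hrX hb hDb hkX hk
      revert i j k
      decide +kernel
    exact no_center hC hX hmin hu hk _ _ (hD.trans (reach_exec huD))
      ((exec_link_self huD).2 ⟨hb, hacc⟩) (fun v => hacc.exec_not_undirected) rfl

theorem exists_reach_directed (hC : C.Clean) (hX : C.Closed X) (hP : NoHole C.support)
    (L : PortLabelling) : ∃ D, Reach L C D ∧ D.Clean ∧ ∀ p q, ¬ D.Undirected p q := by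
  induction X using Finset.strongInduction generalizing C with
  | H X ih =>
    obtain rfl | hne := X.eq_empty_or_nonempty
    · exact ⟨C, Relation.ReflTransGen.refl, hC, fun p q h => notMem_empty p (hX.undirected p q h)⟩
    · obtain ⟨D, Z, hD, hZ, hDZ⟩ := exists_reach_smaller hC hX hP hne L
      obtain ⟨E, hE, h⟩ := ih Z hZ (hC.reach hD) hDZ (hD.support ▸ hP)
      exact ⟨E, hD.trans hE, h⟩

/-! ### Configurations in which all edges are directed -/

theorem Clean.final (hC : C.Clean) (hund : ∀ p q, ¬ C.Undirected p q) (L : PortLabelling) :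
    C.Final L := by
  rintro p ⟨hp, h⟩
  rw [hC.exec_eq_self hp (hund p)] at h
  exact h rfl

theorem claims_or_claims (hund : ∀ p q, ¬ C.Undirected p q)
    (hp : p ∈ C.support) (hq : q ∈ C.support) (h : triGrid.Adj p q) :
    C.Claims p q ∨ C.Claims q p := by
  by_contra! hc
  exact hund p q ⟨hp, hq, h, link_eq_inn.2 hc.1, link_eq_inn.2 hc.2⟩

theorem Clean.valid (hC : C.Clean) (hund : ∀ p q, ¬ C.Undirected p q) (L : PortLabelling) :
    C.Valid L := by
  intro p hp
  refine ⟨fun q hq h => ?_, ?_⟩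
  · simp only [hC.outgoing_iff]
    exact claims_or_claims hund hp hq h
  · rw [← and_assoc, ← arc_iff_R2_R3]
    simp only [hC.outgoing_iff]
    exact (hC p hp).2

theorem Clean.existsUnique_sink (hC : C.Clean) (hund : ∀ p q, ¬ C.Undirected p q)
    (hne : C.support.Nonempty) (hP : NoHole C.support) (hP' : NoCut C.support) :
    ∃! p, C.IsSink p := by
  classical
  have h := euler_eq_card_sinks (O := C.Claims) (X := C.support)
    (fun p q h => (C.mem_of_out p q h).2.1)
    (fun p hp q hq h => claims_or_claims hund hp hq h) (fun p q h => hC.asymm h)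
    (fun p q h => h.adj) (fun p q r => hC.no_triangle) (fun p hp => (hC p hp).2.1)
  rw [euler_eq_six hne hP hP'] at h
  obtain ⟨p, hp⟩ := card_eq_one.1 (show #(C.support.filter fun p => ∀ q, ¬ C.Claims p q) = 1 by
    omega)
  have hmem : ∀ q, C.IsSink q ↔ q = p := by
    intro q
    rw [← mem_singleton, ← hp, mem_filter]
    simp only [IsSink, hC.outgoing_iff]
  exact ⟨p, (hmem p).2 rfl, fun q hq => (hmem q).1 hq⟩

end Config

/-! ### Simply connected sets -/

theorem mem_of_reachable {s : Set Node} {A : Finset Node}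
    (hA : ∀ u ∈ A, u ∈ s → ∀ v ∈ s, triGrid.Adj u v → v ∈ A) {a b : s}
    (h : (triGrid.induce s).Reachable a b) (ha : (a : Node) ∈ A) : (b : Node) ∈ A := by
  obtain ⟨w⟩ := h
  induction w with
  | nil => exact ha
  | @cons u v _ hadj _ ih => exact ih (hA u ha u.2 v v.2 hadj)

theorem SimplyConnected.noHole {P : Finset Node} (h : SimplyConnected P) : NoHole P := by
  intro Y hY
  by_contra! hcon
  obtain ⟨y, hy, hyP⟩ := (ssubset_iff_of_subset hY.1).1 hY
  obtain ⟨z, hz⟩ := Infinite.exists_notMem_finset Y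
  refine hz (mem_of_reachable (fun u hu huP v _ hadj => ?_)
    (h.compl_connected.preconnected ⟨y, hyP⟩ ⟨z, fun hzP => hz (hY.1 hzP)⟩) hy)
  by_contra hv
  exact hcon u hu huP v hv hadj

theorem SimplyConnected.noCut {P : Finset Node} (h : SimplyConnected P) : NoCut P := by
  intro A hA hne hAP
  by_contra! hcon
  obtain ⟨a, ha⟩ := hne
  obtain ⟨b, hb, hbA⟩ := (ssubset_iff_of_subset hA).1 (hA.ssubset_of_ne hAP)
  refine hbA (mem_of_reachable (fun u hu _ v hv hadj => ?_)
    (h.connected.preconnected ⟨a, hA ha⟩ ⟨b, hb⟩) ha)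
  by_contra hvA
  exact hcon u hu v hv hvA hadj

theorem SimplyConnected.nonempty {P : Finset Node} (h : SimplyConnected P) : P.Nonempty := by
  obtain ⟨p⟩ := h.connected.nonempty
  exact ⟨p, p.2⟩

/-! ### Fair executions -/

/-- With the support fixed, a configuration is determined by its finite set of claims. -/
theorem finite_setOf_support_eq (P : Finset Node) : {C : Config | C.support = P}.Finite := by
  classical
  refine Set.Finite.of_injOn (f := fun C : Config =>
    (P ×ˢ P).filter fun e => C.Claims e.1 e.2) (t := ((P ×ˢ P).powerset : Set _)) ?_ ?_
    (Finset.finite_toSet _)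
  · exact fun C _ => mem_powerset.2 (filter_subset _ _)
  · intro C hC D hD h
    have key : ∀ p q, C.Claims p q ↔ D.Claims p q := by
      have mem : ∀ E : Config, E.support = P → ∀ p q,
          E.Claims p q ↔ (p, q) ∈ (P ×ˢ P).filter fun e => E.Claims e.1 e.2 := by
        intro E hE p q
        simp only [mem_filter, mem_product]
        refine ⟨fun h => ?_, And.right⟩
        have := E.mem_of_out p q h
        rw [hE] at this
        exact ⟨⟨this.1, this.2.1⟩, h⟩
      intro p q
      rw [mem C hC, mem D hD]
      exact Finset.ext_iff.1 h (p, q)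
    apply Config.ext (hC.trans hD.symm)
    funext p q
    have := key p q
    cases h₁ : C.link p q <;> cases h₂ : D.link p q <;> simp_all [Config.Claims]

theorem exists_infinitelyOften {S : ℕ → Config} (h : ∀ i, (S i).support = (S 0).support) :
    ∃ C, InfinitelyOften S C := by
  have := (finite_setOf_support_eq (S 0).support).to_subtype
  obtain ⟨C, hC⟩ := Finite.exists_infinite_fiber
    (fun i => (⟨S i, h i⟩ : {C : Config | C.support = (S 0).support}))
  refine ⟨C, fun n => ?_⟩
  obtain ⟨i, hi, hn⟩ := (Set.infinite_coe_iff.1 hC).exists_gt n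
  exact ⟨i, hn.le, congrArg Subtype.val hi⟩

theorem InfinitelyOften.reach {L : PortLabelling} {S : ℕ → Config}
    (hS : ∀ C C', InfinitelyOften S C → C.SeqSuccessor L C' → InfinitelyOften S C') {C D : Config}
    (hC : InfinitelyOften S C) (h : Config.Reach L C D) : InfinitelyOften S D := by
  induction h with
  | refl => exact hC
  | tail _ hs ih => exact hS _ _ ih hs

theorem Config.SeqSuccessor.successor {L : PortLabelling} {C C' : Config}
    (h : C.SeqSuccessor L C') : C.Successor L C' := by
  obtain ⟨p, hp, rfl⟩ := h
  exact ⟨{p}, singleton_nonempty p, fun q hq => by rwa [mem_singleton.1 hq], rfl⟩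

theorem IsSeqExecution.isExecution {L : PortLabelling} {S : ℕ → Config}
    (h : IsSeqExecution L S) : IsExecution L S :=
  fun i => (h i).imp_left Config.SeqSuccessor.successor

theorem IsExecution.support_eq {L : PortLabelling} {S : ℕ → Config} (h : IsExecution L S) (i : ℕ) :
    (S i).support = (S 0).support := by
  induction i with
  | zero => rfl
  | succ i ih =>
    obtain ⟨Q, -, -, e⟩ | ⟨-, e⟩ := h i
    · rw [e]
      exact ih
    · rw [e, ih]

end ParticleSystem

theorem theorem2 (L : ParticleSystem.PortLabelling) (S : ℕ → ParticleSystem.Config)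
    (hP : ParticleSystem.SimplyConnected (S 0).support)
    (hS : ParticleSystem.IsGoudaFairExecution L S ∨ ParticleSystem.IsSeqGoudaFairExecution L S) :
    ∃ n, (S n).Final L ∧ (S n).Valid L ∧ ∃! p, (S n).IsSink p := by
  have hex : ParticleSystem.IsExecution L S := hS.elim And.left fun h => h.1.isExecution
  have hfair : ∀ C C', ParticleSystem.InfinitelyOften S C → C.SeqSuccessor L C' →
      ParticleSystem.InfinitelyOften S C' := by
    obtain h | h := hS
    · exact fun C C' hC hs => h.2 C C' hC hs.successor
    · exact h.2
  obtain ⟨C, hC⟩ := ParticleSystem.exists_infinitelyOften hex.support_eq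
  have hsupp : C.support = (S 0).support := by
    obtain ⟨i, -, rfl⟩ := hC 0
    exact hex.support_eq i
  obtain ⟨D, hD, hDclean⟩ := ParticleSystem.Config.exists_reach_clean L C
  have hDsupp : D.support = (S 0).support := hD.support.trans hsupp
  obtain ⟨E, hE, hEclean, hund⟩ := ParticleSystem.Config.exists_reach_directed hDclean
    D.closed_support (hDsupp ▸ hP.noHole) L
  have hEsupp : E.support = (S 0).support := hE.support.trans hDsupp
  obtain ⟨n, -, rfl⟩ := hC.reach hfair (hD.trans hE) 0
  exact ⟨n, hEclean.final hund L, hEclean.valid hund L, hEclean.existsUnique_sink hund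
    (hEsupp ▸ hP.nonempty) (hEsupp ▸ hP.noHole) (hEsupp ▸ hP.noCut)⟩
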